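/- Let $n\ge1$ be an integer and let $p,q$ be nonnegative integers with $pq>0$. Put $$ S^{pq}(r) := r^{p+q}\,\frac{{}_2F_1(p,q;p+q+n;r^2)}{{}_2F_1(p,q;p+q+n;1)}, \qquad 0\le r\le 1, $$ and, for $s\in\mathbb C$ with $\operatorname{Re}s>-1$, $$ C_{pq}(s) := \frac{\Gamma(n+s+1)}{\pi^n\,\Gamma(s+1)} \int_0^1 S^{pq}(r)^2\, \frac{2\pi^n}{\Gamma(n)}\, (1-r^2)^s\, r^{2n-1}\,dr . $$ (These are the coefficients in the formula $\|f\|_s^2=\sum_{p,q}C_{pq}(s)\|f_{pq}\|^2_{\partial\mathbf B^n}$ for the norm of the Moebius-harmonic weighted Bergman space on the unit ball of $\mathbb C^n$.) Then $C_{pq}$ extends to a meromorphic function on all of $\mathbb C$, which is holomorphic except for double poles (poles of order exactly $2$) at the points $s=-n-1,-n-2,\dots,-2n$ and triple poles (poles of order exactly $3$) at the points $s=-2n-1-j$, $j=0,1,2,\dots$. The double pole at $s=-n-1$ has strength $$ \lim_{s\to-n-1}(s+n+1)^2\,C_{pq}(s) = \frac{2\,(p)_n\,(q)_n}{\Gamma(n)^2},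 $$ where $(a)_n=a(a+1)\cdots(a+n-1)$. -/

import Mathlib

open Filter Topology

noncomputable section

/-- The radial profile `S^{pq}(r) = r^{p+q} F(p,q;p+q+n;r²) / F(p,q;p+q+n;1)`, for `0 ≤ r ≤ 1`, of the
solutions of the Dirichlet problem for the invariant Laplacian on the unit ball of `ℂⁿ` whose boundary
data are bigraded spherical harmonics of bidegree `(p,q)`; `F` is Gauss's hypergeometric function
`₂F₁`, given by its power series. -/
def mhRadial (n p q : ℕ) (r : ℝ) : ℝ :=
  r ^ (p + q) *
    ordinaryHypergeometric (p : ℝ) (q : ℝ) ((p : ℝ) + (q : ℝ) + (n : ℝ)) (r ^ 2) /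
      ordinaryHypergeometric (p : ℝ) (q : ℝ) ((p : ℝ) + (q : ℝ) + (n : ℝ)) (1 : ℝ)

/-- The coefficient `C_{pq}(s)`, for `Re s > -1`, of the norm `‖f‖_s² = ∑ C_{pq}(s) ‖f_{pq}‖²` of the
Moebius-harmonic weighted Bergman space on the unit ball of `ℂⁿ`. -/
def mhCoeff (n p q : ℕ) (s : ℂ) : ℂ :=
  Complex.Gamma ((n : ℂ) + s + 1) / ((Real.pi : ℂ) ^ n * Complex.Gamma (s + 1)) *
    ∫ r in (0 : ℝ)..1,
      ((mhRadial n p q r : ℝ) : ℂ) ^ 2 *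
        (2 * (Real.pi : ℂ) ^ n / Complex.Gamma (n : ℂ)) *
        ((1 - r ^ 2 : ℝ) : ℂ) ^ s * (r : ℂ) ^ (2 * n - 1)

end

/-!
Write `c = p + q + n` and `x = 1 - r ^ 2`. The substitution `x = 1 - r ^ 2` turns `C_{pq}(s)` into
`(s + 1) ⋯ (s + n) / Γ(n)` times the Mellin transform at `s + 1` of
`h(x) = (1 - x) ^ (c - 1) * u(x) ^ 2` on `(0, 1]`, where `u(x) = F(1 - x) / F(1)` and
`F = ₂F₁(p, q; c; ·)` (`mhCoeff_eq_mellin`). A term `x ^ k * (log x) ^ i` in the expansion of `h`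
at `0` produces a pole of order `i + 1` at `s = -k - 1` (`exists_mellin_continuation`), so everything
reduces to knowing which terms occur in the expansion of `h`.

Since `p` and `q` are integers, this expansion is elementary. The coefficients of `F` are the moments
on `[0, 1]` of an explicit polynomial (`hypTerm_eq_unitMoment`, by the Chu–Vandermonde identity), and
the generating function of the moments of a polynomial is a rational function plus a logarithm
(`hasSum_unitMoment`). This gives `(1 - x) ^ (c - 1) * u = Q + β * x ^ n * P * log x` with
polynomials `Q` and `P = ₂F₁(1 - p, 1 - q; n + 1; X)`, where the constant `β` involves `F(1)`, which
is computed by Gauss's summation formula (`hasSum_hypTerm`). The expansion of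
`A = Q / (1 - x) ^ (c - 1)` below order `n` is the Taylor expansion of `u`, computed termwise: it is
`₂F₁(p, q; 1 - n; x)`, truncated (`exists_hypSum_log_expansion`).

Hence `h = (1 - x) ^ (1 - c) * Q ^ 2 + 2 β x ^ n A P log x +
β ^ 2 x ^ (2 n) (1 - x) ^ (1 - c) P ^ 2 (log x) ^ 2`.
The simple poles at `-1, …, -n` are cancelled by the factor `(s + 1) ⋯ (s + n)`. The triple poles are
there because `(1 - x) ^ (1 - c) * P ^ 2` has positive coefficients
(`coeff_logPoly_sq_div_pos`). The double poles are there because the coefficients of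
`₂F₁(1 - p, 1 - q; 1 + n; x) * ₂F₁(p, q; 1 - n; x)` below order `n` alternate in sign
(`coeff_mul_hypergeometric_pos`): this product satisfies the symmetric square of Gauss's equation,
hence a three-term recurrence, from which the signs follow by induction. The strength of the first
double pole is read off from `β`.
-/

/-! ### The product of two hypergeometric series with reflected parameters -/

/-- The Euler operator `f ↦ X f'` on power series. -/
noncomputable def eulerOp (f : PowerSeries ℝ) : PowerSeries ℝ :=
  PowerSeries.X * PowerSeries.derivative ℝ f

lemma coeff_eulerOp (f : PowerSeries ℝ) (k : ℕ) :
    PowerSeries.coeff k (eulerOp f) = k * PowerSeries.coeff k f := by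
  cases k with
  | zero => simp [eulerOp]
  | succ k =>
    rw [eulerOp, PowerSeries.coeff_succ_X_mul, PowerSeries.coeff_derivative]
    push_cast; ring

lemma eulerOp_add (f g : PowerSeries ℝ) : eulerOp (f + g) = eulerOp f + eulerOp g := by
  simp [eulerOp, mul_add]

lemma eulerOp_sub (f g : PowerSeries ℝ) : eulerOp (f - g) = eulerOp f - eulerOp g := by
  simp [eulerOp, mul_sub]

lemma eulerOp_mul (f g : PowerSeries ℝ) : eulerOp (f * g) = eulerOp f * g + f * eulerOp g := by
  simp only [eulerOp, Derivation.leibniz, smul_eq_mul]; ring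

lemma eulerOp_C (a : ℝ) : eulerOp (PowerSeries.C a) = 0 := by
  simp [eulerOp]

lemma eulerOp_X : eulerOp (PowerSeries.X) = PowerSeries.X := by
  simp [eulerOp]

/-- The hypergeometric recurrence for the coefficients, up to index `N`, is Gauss's differential
equation modulo `X ^ N`. -/
lemma X_pow_dvd_hypergeometric_eulerOp (a b l : ℝ) (N : ℕ) (f : PowerSeries ℝ)
    (h : ∀ k : ℕ, k + 1 < N → (k + 1 : ℝ) * (k + 1 - l) * PowerSeries.coeff (k + 1) f =
      (k + a) * (k + b) * PowerSeries.coeff k f) :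
    PowerSeries.X ^ N ∣ (1 - PowerSeries.X) * eulerOp (eulerOp f) - PowerSeries.C l * eulerOp f -
      PowerSeries.X * (PowerSeries.C (a + b) * eulerOp f + PowerSeries.C (a * b) * f) := by
  rw [PowerSeries.X_pow_dvd_iff]
  intro m hm
  cases m with
  | zero =>
    simp [sub_mul, eulerOp]
  | succ k =>
    have := h k hm
    simp only [sub_mul, one_mul, map_sub (PowerSeries.coeff _), PowerSeries.coeff_succ_X_mul,
      map_add (PowerSeries.coeff _), PowerSeries.coeff_C_mul, coeff_eulerOp]
    push_cast
    linear_combination this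

/-- The product of a solution of Gauss's equation with parameters `(a, b; 1 - l)` and a solution of
the one with parameters `(1 - a, 1 - b; 1 + l)` satisfies a third order equation, the symmetric
square of Gauss's equation. Its coefficients obey a three-term recurrence. -/
lemma coeff_mul_hypergeometric_recurrence (a b l : ℝ) (N : ℕ) (P A : PowerSeries ℝ)
    (hP : ∀ k : ℕ, (k + 1 : ℝ) * (k + 1 + l) * PowerSeries.coeff (k + 1) P =
      (k + 1 - a) * (k + 1 - b) * PowerSeries.coeff k P)
    (hA : ∀ k : ℕ, k + 1 < N → (k + 1 : ℝ) * (k + 1 - l) * PowerSeries.coeff (k + 1) A =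
      (k + a) * (k + b) * PowerSeries.coeff k A) (m : ℕ) (hm : m + 2 < N) :
    (m + 2 : ℝ) * ((m + 2) ^ 2 - l ^ 2) * PowerSeries.coeff (m + 2) (P * A) =
      (2 * m + 3) * ((m + 1) ^ 2 + (m + 1) + (2 * a * b + (l - 1) * (a + b - 1))) *
        PowerSeries.coeff (m + 1) (P * A) -
      (m + 1) * ((m + 1) ^ 2 - (b - a) ^ 2) * PowerSeries.coeff m (P * A) := by
  have h1 := X_pow_dvd_hypergeometric_eulerOp a b l N A hA
  have h2 := X_pow_dvd_hypergeometric_eulerOp (1 - a) (1 - b) (-l) N P (fun k _ => by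
    have := hP k
    linear_combination this)
  obtain ⟨e, he⟩ := h1
  obtain ⟨d, hd⟩ := h2
  have hX : ∀ M : ℕ, eulerOp (PowerSeries.X ^ M) = PowerSeries.C (M : ℝ) * PowerSeries.X ^ M := by
    intro M
    ext k
    rw [coeff_eulerOp, PowerSeries.coeff_C_mul, PowerSeries.coeff_X_pow]
    split_ifs with h
    · rw [h]
    · simp
  have hone : eulerOp 1 = 0 := by simpa using eulerOp_C 1
  have he' := congrArg eulerOp he
  have hd' := congrArg eulerOp hd
  simp only [eulerOp_mul, eulerOp_sub, eulerOp_add, eulerOp_C, eulerOp_X, hX, hone] at he' hd'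
  simp only [map_add, map_mul, map_sub, map_one, map_neg] at he hd he' hd'
  set κ := 2 * a * b + (l - 1) * (a + b - 1) with hκ
  -- `(1 - X)` times the derivatives of the two equations, corrected by multiples of the equations.
  have key : PowerSeries.X ^ N ∣
      eulerOp (eulerOp (eulerOp (P * A))) - PowerSeries.C (l ^ 2) * eulerOp (P * A) -
      PowerSeries.X * (PowerSeries.C 2 * eulerOp (eulerOp (eulerOp (P * A))) +
        PowerSeries.C 3 * eulerOp (eulerOp (P * A)) +
        PowerSeries.C (1 + 2 * κ) * eulerOp (P * A) + PowerSeries.C κ * (P * A)) +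
      PowerSeries.X * (PowerSeries.X * (eulerOp (eulerOp (eulerOp (P * A))) +
        PowerSeries.C 3 * eulerOp (eulerOp (P * A)) +
        PowerSeries.C (3 - (b - a) ^ 2) * eulerOp (P * A) +
        PowerSeries.C (1 - (b - a) ^ 2) * (P * A))) := by
    refine ⟨(1 - PowerSeries.X) * (A * (PowerSeries.C (N : ℝ) * d + eulerOp d) +
        P * (PowerSeries.C (N : ℝ) * e + eulerOp e)) +
      (3 * (1 - PowerSeries.X) * eulerOp A +
        (-PowerSeries.C l - PowerSeries.X * (PowerSeries.C a + PowerSeries.C b)) * A) * d +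
      (3 * (1 - PowerSeries.X) * eulerOp P +
        (PowerSeries.C l - PowerSeries.X * (2 - PowerSeries.C a - PowerSeries.C b)) * P) * e, ?_⟩
    simp only [hκ, eulerOp_mul, eulerOp_add, map_add, map_mul, map_sub, map_pow, map_one,
      map_ofNat]
    linear_combination (1 - PowerSeries.X) * A * hd' + (1 - PowerSeries.X) * P * he' +
      (3 * (1 - PowerSeries.X) * eulerOp A +
        (-PowerSeries.C l - PowerSeries.X * (PowerSeries.C a + PowerSeries.C b)) * A) * hd +
      (3 * (1 - PowerSeries.X) * eulerOp P +
        (PowerSeries.C l - PowerSeries.X * (2 - PowerSeries.C a - PowerSeries.C b)) * P) * he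
  rw [PowerSeries.X_pow_dvd_iff] at key
  have := key (m + 2) hm
  simp only [map_add (PowerSeries.coeff _), map_sub (PowerSeries.coeff _),
    PowerSeries.coeff_succ_X_mul, PowerSeries.coeff_C_mul, coeff_eulerOp] at this
  push_cast at this
  linear_combination this

/-- A solution of the three-term recurrence, with alternating signs removed, stays positive below
index `n`. While the last term of the recurrence is negative, that is for `m ≤ d`, positivity is
propagated by the lower bound `(d + m + 1) / (n - m - 1)` for the ratio of consecutive terms. -/
lemma pos_of_three_term_recurrence (n d : ℕ) (κ : ℝ) (hκ : (n + 1 : ℝ) * (d + 1) ≤ κ)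
    (v : ℕ → ℝ) (h0 : 0 < v 0)
    (h1 : 1 < n → ((n : ℝ) ^ 2 - 1) * v 1 = κ * v 0)
    (hrec : ∀ m : ℕ, m + 2 < n → (m + 2 : ℝ) * ((n : ℝ) ^ 2 - (m + 2) ^ 2) * v (m + 2) =
      (2 * m + 3) * ((m + 1) ^ 2 + (m + 1) + κ) * v (m + 1) +
        (m + 1) * ((m + 1) ^ 2 - (d : ℝ) ^ 2) * v m) (m : ℕ) (hm : m < n) : 0 < v m := by
  have hκ0 : 0 < κ := lt_of_lt_of_le (by positivity) hκ
  have main : ∀ m : ℕ, m + 1 < n → 0 < v m ∧ 0 < v (m + 1) ∧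
      (m ≤ d → (d + m + 1 : ℝ) * v m ≤ (n - (m + 1)) * v (m + 1)) := by
    intro m
    induction m with
    | zero =>
      intro hn
      have hn' : (1 : ℝ) < n := by exact_mod_cast hn
      have e := h1 hn
      have hv1 : 0 < v 1 := by
        have : 0 < ((n : ℝ) ^ 2 - 1) * v 1 := by rw [e]; positivity
        exact (pos_iff_pos_of_mul_pos this).mp (by nlinarith)
      refine ⟨h0, hv1, fun _ => ?_⟩
      have : (n + 1 : ℝ) * ((d + 1) * v 0) ≤ (n + 1) * ((n - 1) * v 1) := by
        nlinarith [mul_le_mul_of_nonneg_right hκ h0.le]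
      have := le_of_mul_le_mul_left this (by positivity)
      simpa using this
    | succ m ih =>
      intro hn
      obtain ⟨hvm, hvM, hr⟩ := ih (by omega)
      have e := hrec m (by omega)
      have hn' : (m + 2 : ℝ) < n := by exact_mod_cast hn
      have hcoef : 0 < (m + 2 : ℝ) * ((n : ℝ) ^ 2 - (m + 2) ^ 2) :=
        mul_pos (by positivity) (by nlinarith)
      -- the lower bound for the ratio, cleared of denominators
      have hratio : m + 1 ≤ d → (m + 2 : ℝ) * (n + m + 2) * ((d + m + 2) * v (m + 1)) ≤
          (m + 2 : ℝ) * (n + m + 2) * ((n - (m + 2)) * v (m + 2)) := by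
        intro hd
        have hd' : (m + 1 : ℝ) ≤ d := by exact_mod_cast hd
        have i1 : (m + 1 : ℝ) * (d - (m + 1)) * ((d + m + 1) * v m) ≤
            (m + 1) * (d - (m + 1)) * ((n - (m + 1)) * v (m + 1)) :=
          mul_le_mul_of_nonneg_left (hr (by omega)) (mul_nonneg (by positivity) (by linarith))
        have i2 : (2 * m + 3 : ℝ) * v (m + 1) * ((n + 1 : ℝ) * (d + 1)) ≤
            (2 * m + 3 : ℝ) * v (m + 1) * κ := mul_le_mul_of_nonneg_left hκ (by positivity)
        linear_combination i1 + i2 - e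
      have hv2 : 0 < v (m + 2) := by
        rcases le_total (m + 1) d with hd | hd
        · have := hratio hd
          have h3 : 0 < (m + 2 : ℝ) * (n + m + 2) * ((n - (m + 2)) * v (m + 2)) :=
            lt_of_lt_of_le (by positivity) this
          have h4 := (pos_iff_pos_of_mul_pos h3).mp (by positivity)
          exact (pos_iff_pos_of_mul_pos h4).mp (by linarith)
        · have hd' : (d : ℝ) ≤ m + 1 := by exact_mod_cast hd
          have : 0 < (m + 2 : ℝ) * ((n : ℝ) ^ 2 - (m + 2) ^ 2) * v (m + 2) := by
            rw [e]
            have : 0 ≤ (m + 1 : ℝ) ^ 2 - (d : ℝ) ^ 2 := by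
              have : (0 : ℝ) ≤ d := by positivity
              nlinarith
            positivity
          exact (pos_iff_pos_of_mul_pos this).mp hcoef
      refine ⟨hvM, hv2, fun hd => ?_⟩
      have := le_of_mul_le_mul_left (hratio hd) (by positivity)
      push_cast
      linear_combination this
  rcases Nat.lt_or_ge (m + 1) n with h | h
  · exact (main m h).1
  · cases m with
    | zero => exact h0
    | succ m => exact (main m (by omega)).2.1

/-- The coefficients of `₂F₁(1 - p, 1 - q; 1 + n; X) * ₂F₁(p, q; 1 - n; X)` below degree `n`
alternate in sign, and do not vanish. -/
lemma coeff_mul_hypergeometric_pos (n p q : ℕ) (hp : 1 ≤ p) (hq : 1 ≤ q) (P A : PowerSeries ℝ)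
    (hP0 : PowerSeries.coeff 0 P = 1) (hA0 : PowerSeries.coeff 0 A = 1)
    (hP : ∀ k : ℕ, (k + 1 : ℝ) * (k + 1 + n) * PowerSeries.coeff (k + 1) P =
      (k + 1 - p) * (k + 1 - q) * PowerSeries.coeff k P)
    (hA : ∀ k : ℕ, k + 1 < n → (k + 1 : ℝ) * (k + 1 - n) * PowerSeries.coeff (k + 1) A =
      (k + p) * (k + q) * PowerSeries.coeff k A) (m : ℕ) (hm : m < n) :
    0 < (-1) ^ m * PowerSeries.coeff m (P * A) := by
  wlog hpq : p ≤ q generalizing p q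
  · exact this q p hq hp (fun k => by linear_combination hP k)
      (fun k hk => by linear_combination hA k hk) (by omega)
  obtain ⟨d, rfl⟩ := Nat.exists_eq_add_of_le hpq
  have hp' : (1 : ℝ) ≤ p := by exact_mod_cast hp
  have hn' : (1 : ℝ) ≤ n := by exact_mod_cast (by omega : 1 ≤ n)
  have hd' : (0 : ℝ) ≤ d := by positivity
  push_cast at hP hA
  refine pos_of_three_term_recurrence n d
    (2 * p * (p + d) + (n - 1) * (p + (p + d) - 1)) ?_
    (fun m => (-1) ^ m * PowerSeries.coeff m (P * A)) ?_ ?_ ?_ m hm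
  · nlinarith [mul_nonneg (sub_nonneg.2 hn') (sub_nonneg.2 hp'), mul_nonneg hd' (sub_nonneg.2 hp')]
  · simp [PowerSeries.coeff_mul, hP0, hA0]
  · intro hn
    have e1 := hP 0
    have e2 := hA 0 (by omega)
    simp only [Nat.cast_zero, zero_add, hP0, hA0, PowerSeries.coeff_mul,
      Finset.Nat.antidiagonal_succ] at e1 e2 ⊢
    simp [hP0, hA0] at e1 e2 ⊢
    linear_combination (n + 1 : ℝ) * e2 - (n - 1 : ℝ) * e1
  · intro m hm
    have := coeff_mul_hypergeometric_recurrence p (p + d) n n P A hP hA m hm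
    rw [pow_succ, pow_succ]
    linear_combination (-1) ^ (m + 1) * this

/-! ### Gauss's summation formula for integer parameters -/

/-- The `m`-th coefficient `(a)_m (b)_m / ((c)_m m!)` of Gauss's hypergeometric series. -/
noncomputable def hypTerm (a b c : ℝ) (m : ℕ) : ℝ :=
  (ascPochhammer ℝ m).eval a * (ascPochhammer ℝ m).eval b /
    ((ascPochhammer ℝ m).eval c * (m.factorial : ℝ))

lemma hypTerm_zero (a b c : ℝ) : hypTerm a b c 0 = 1 := by simp [hypTerm]

lemma ascPochhammer_succ_eval_left (a : ℝ) (m : ℕ) :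
    (ascPochhammer ℝ (m + 1)).eval a = a * (ascPochhammer ℝ m).eval (a + 1) := by
  simp [ascPochhammer_succ_left]

/-- Contiguity in the first parameter, as a telescoping identity for partial sums. -/
lemma hypTerm_sum_contiguous (a b c : ℝ) (hc : 0 < c) (J : ℕ) :
    (c - (a + 1) - b) * ∑ j ∈ Finset.range (J + 1), hypTerm (a + 1) b c j =
      (c - (a + 1)) * ∑ j ∈ Finset.range (J + 1), hypTerm a b c j -
        (b + J) * hypTerm (a + 1) b c J := by
  induction J with
  | zero => simp [hypTerm_zero]
  | succ J ih =>
    rw [Finset.sum_range_succ, Finset.sum_range_succ _ (J + 1), mul_add, mul_add, ih]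
    have h1 : (ascPochhammer ℝ J).eval c ≠ 0 := (ascPochhammer_pos J c hc).ne'
    have h2 : (J.factorial : ℝ) ≠ 0 := by positivity
    have h3 : c + (J : ℝ) ≠ 0 := by positivity
    have h4 : (J : ℝ) + 1 ≠ 0 := by positivity
    simp only [hypTerm]
    rw [ascPochhammer_succ_eval_left a, ascPochhammer_succ_eval J (a + 1),
      ascPochhammer_succ_eval J b, ascPochhammer_succ_eval J c, Nat.factorial_succ]
    push_cast
    field_simp
    ring

lemma ascPochhammer_eval_succ_cast (a m : ℕ) :
    (ascPochhammer ℝ m).eval ((a : ℝ) + 1) = ((a + m).factorial : ℝ) / (a.factorial : ℝ) := by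
  have h : (ascPochhammer ℝ m).eval ((a : ℝ) + 1) = ((a + 1).ascFactorial m : ℝ) := by
    rw [← ascPochhammer_nat_eq_ascFactorial, ascPochhammer_eval_cast]; push_cast; rfl
  rw [h, eq_div_iff (by positivity), mul_comm]
  exact_mod_cast Nat.factorial_mul_ascFactorial a m

lemma hypTerm_eq_factorial (a b n m : ℕ) :
    hypTerm (a + 1) (b + 1) ((a + b + n + 1 : ℕ) + 1) m =
      ((a + m).factorial * (b + m).factorial * (a + b + n + 1).factorial : ℝ) /
        (a.factorial * b.factorial * (a + b + n + 1 + m).factorial * m.factorial) := by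
  rw [hypTerm, ascPochhammer_eval_succ_cast, ascPochhammer_eval_succ_cast,
    ascPochhammer_eval_succ_cast]
  field_simp

lemma hypTerm_nonneg (a b c : ℝ) (ha : 0 ≤ a) (hb : 0 ≤ b) (hc : 0 < c) (m : ℕ) :
    0 ≤ hypTerm a b c m := by
  have h : ∀ x : ℝ, 0 ≤ x → 0 ≤ (ascPochhammer ℝ m).eval x := fun x hx => by
    rcases hx.eq_or_lt with rfl | hx
    · rw [ascPochhammer_eval_zero]; split_ifs <;> norm_num
    · exact (ascPochhammer_pos m x hx).le
  exact div_nonneg (mul_nonneg (h a ha) (h b hb)) (mul_nonneg (h c hc.le) (by positivity))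

/-- The coefficients of a hypergeometric series with `c - a - b = n` are `O(m ^ (-n - 1))`. -/
lemma hypTerm_le (a b n : ℕ) : ∃ K : ℝ, 0 ≤ K ∧ ∀ m : ℕ,
    hypTerm (a + 1) (b + 1) ((a + b + n + 1 : ℕ) + 1) m ≤ K / ((m : ℝ) + 1) ^ (n + 1) := by
  refine ⟨((a + b + n + 1).factorial : ℝ) / (a.factorial * b.factorial) * (a + 1) ^ a,
    by positivity, fun m => ?_⟩
  have h1 : ((a + m).factorial : ℝ) ≤ m.factorial * ((a + 1 : ℝ) * (m + 1)) ^ a := by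
    have e : m.factorial * (m + 1).ascFactorial a = (m + a).factorial :=
      Nat.factorial_mul_ascFactorial m a
    have e2 : (m + 1).ascFactorial a ≤ ((a + 1) * (m + 1)) ^ a := by
      refine (Nat.ascFactorial_le_pow_add m a).trans (Nat.pow_le_pow_left ?_ a)
      nlinarith
    rw [add_comm, ← e]
    push_cast
    have : ((m + 1).ascFactorial a : ℝ) ≤ ((a + 1) * (m + 1)) ^ a := by exact_mod_cast e2
    gcongr
  have h2 : ((b + m).factorial : ℝ) * (m + 1) ^ (a + n + 1) ≤ (a + b + n + 1 + m).factorial := by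
    have e : (b + m).factorial * (b + m + 1).ascFactorial (a + n + 1) =
        (b + m + (a + n + 1)).factorial := Nat.factorial_mul_ascFactorial (b + m) (a + n + 1)
    have e2 : (m + 1) ^ (a + n + 1) ≤ (b + m + 1).ascFactorial (a + n + 1) :=
      (Nat.pow_le_pow_left (by omega) _).trans (Nat.pow_succ_le_ascFactorial _ _)
    have e3 : a + b + n + 1 + m = b + m + (a + n + 1) := by ring
    rw [e3, ← e]
    exact_mod_cast Nat.mul_le_mul_left _ e2
  rw [hypTerm_eq_factorial, div_le_div_iff₀ (by positivity) (by positivity)]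
  calc ((a + m).factorial * (b + m).factorial * (a + b + n + 1).factorial : ℝ) * (m + 1) ^ (n + 1)
      ≤ (m.factorial * ((a + 1 : ℝ) * (m + 1)) ^ a * (b + m).factorial *
          (a + b + n + 1).factorial : ℝ) * (m + 1) ^ (n + 1) := by gcongr
    _ = m.factorial * (a + 1) ^ a * (a + b + n + 1).factorial *
          ((b + m).factorial * (m + 1) ^ (a + n + 1)) := by rw [mul_pow]; ring
    _ ≤ m.factorial * (a + 1) ^ a * (a + b + n + 1).factorial * (a + b + n + 1 + m).factorial := by
        gcongr
    _ = _ := by field_simp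

lemma tendsto_mul_hypTerm (a b N : ℕ) :
    Tendsto (fun J : ℕ => ((b : ℝ) + 1 + J) *
      hypTerm (a + 1) (b + 1) ((a + b + (N + 1) + 1 : ℕ) + 1) J) atTop (𝓝 0) := by
  obtain ⟨K, hK, h⟩ := hypTerm_le a b (N + 1)
  have hlim : Tendsto (fun J : ℕ => ((b : ℝ) + 1) * K * (1 / ((J : ℝ) + 1))) atTop (𝓝 0) := by
    simpa using tendsto_one_div_add_atTop_nhds_zero_nat.const_mul (((b : ℝ) + 1) * K)
  refine squeeze_zero (fun J => ?_) (fun J => ?_) hlim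
  · exact mul_nonneg (by positivity)
      (hypTerm_nonneg _ _ _ (by positivity) (by positivity) (by positivity) _)
  · have hJ : (1 : ℝ) ≤ (J : ℝ) + 1 := by linarith [Nat.cast_nonneg (α := ℝ) J]
    calc _ ≤ ((b : ℝ) + 1) * (J + 1) * (K / ((J : ℝ) + 1) ^ (N + 1 + 1)) := by
          refine mul_le_mul ?_ (h J)
            (hypTerm_nonneg _ _ _ (by positivity) (by positivity) (by positivity) _)
            (by positivity)
          nlinarith [Nat.cast_nonneg (α := ℝ) J, Nat.cast_nonneg (α := ℝ) b,
            mul_nonneg (Nat.cast_nonneg (α := ℝ) J) (Nat.cast_nonneg (α := ℝ) b)]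
      _ ≤ ((b : ℝ) + 1) * (J + 1) * (K / ((J : ℝ) + 1) ^ 2) := by
          gcongr
          omega
      _ = _ := by field_simp

/-- Gauss's summation formula
`₂F₁(p, b + 1; p + b + N + 2; 1) = (p + b + N + 1)! N! / ((b + N + 1)! (p + N)!)`,
by descent in `p` through the contiguity relation. -/
lemma hasSum_hypTerm (b : ℕ) (p : ℕ) : ∀ N : ℕ,
    HasSum (hypTerm p (b + 1) ((p + b + N + 1 : ℕ) + 1))
      (((p + b + N + 1).factorial * N.factorial : ℝ) /
        ((b + N + 1).factorial * (p + N).factorial)) := by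
  induction p with
  | zero =>
    intro N
    have : ∀ m : ℕ, m ≠ 0 → hypTerm (0 : ℕ) (b + 1) ((0 + b + N + 1 : ℕ) + 1) m = 0 := by
      intro m hm
      simp [hypTerm, hm]
    have h := hasSum_single 0 this
    rw [hypTerm_zero] at h
    convert h using 1
    rw [zero_add, zero_add]
    field_simp
  | succ p ih =>
    intro N
    rw [hasSum_iff_tendsto_nat_of_nonneg
      (hypTerm_nonneg _ _ _ (by positivity) (by positivity) (by positivity)),
      ← tendsto_add_atTop_iff_nat 1]
    have h1 := (tendsto_add_atTop_iff_nat 1).2 (ih (N + 1)).tendsto_sum_nat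
    have h2 := tendsto_mul_hypTerm p b N
    have hN : (N + 1 : ℝ) ≠ 0 := by positivity
    have h3 := ((h1.const_mul ((b : ℝ) + N + 2)).sub h2).const_mul (1 / (N + 1 : ℝ))
    have e1 : p + 1 + b + N + 1 = p + b + (N + 1) + 1 := by ring
    rw [e1]
    convert h3 using 1
    · funext J
      have := hypTerm_sum_contiguous p (b + 1) ((p + b + (N + 1) + 1 : ℕ) + 1)
        (by positivity) J
      push_cast at this ⊢
      field_simp
      linear_combination this
    · congr 1
      rw [show b + (N + 1) + 1 = (b + N + 1) + 1 by ring, show p + (N + 1) = p + 1 + N by ring,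
        Nat.factorial_succ N, Nat.factorial_succ (b + N + 1)]
      push_cast
      field_simp
      ring

/-! ### The logarithmic form of the hypergeometric function -/

lemma integral_pow_mul_one_sub_pow (j : ℕ) : ∀ i : ℕ,
    ∫ y in (0 : ℝ)..1, y ^ i * (1 - y) ^ j =
      (i.factorial * j.factorial : ℝ) / (i + j + 1).factorial := by
  induction j with
  | zero =>
    intro i
    simp only [pow_zero, mul_one, integral_pow, one_pow, add_zero, Nat.factorial_succ]
    push_cast
    field_simp
    simp
  | succ j ih =>
    intro i
    have e : ∀ y : ℝ, y ^ i * (1 - y) ^ (j + 1) = y ^ i * (1 - y) ^ j - y ^ (i + 1) * (1 - y) ^ j :=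
      fun y => by ring
    simp only [e]
    rw [intervalIntegral.integral_sub (Continuous.intervalIntegrable (by fun_prop) _ _)
      (Continuous.intervalIntegrable (by fun_prop) _ _), ih, ih,
      show i + 1 + j + 1 = i + j + 1 + 1 by ring, show i + (j + 1) + 1 = i + j + 1 + 1 by ring,
      Nat.factorial_succ (i + j + 1), Nat.factorial_succ i, Nat.factorial_succ j]
    push_cast
    field_simp
    ring

/-- The Chu–Vandermonde identity in the form of an iterated difference of binomials. -/
lemma sum_neg_one_pow_choose_mul_choose (a : ℕ) : ∀ M r : ℕ,
    ∑ k ∈ Finset.range (a + 1), (-1 : ℝ) ^ k * (a.choose k) * ((a + M - k).choose (a + r)) =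
      M.choose r := by
  induction a with
  | zero => intro M r; simp
  | succ a ih =>
    intro M r
    have h1 := ih (M + 1) (r + 1)
    have h2 := ih M (r + 1)
    rw [Nat.choose_succ_succ] at h1
    push_cast at h1
    have h3 : ∑ k ∈ Finset.range (a + 1 + 1), (-1 : ℝ) ^ k * ((a + 1).choose k) *
        ((a + 1 + M - k).choose (a + 1 + r)) =
        ∑ k ∈ Finset.range (a + 1), (-1 : ℝ) ^ k * (a.choose k) *
          ((a + (M + 1) - k).choose (a + (r + 1))) -
        ∑ k ∈ Finset.range (a + 1), (-1 : ℝ) ^ k * (a.choose k) *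
          ((a + M - k).choose (a + (r + 1))) := by
      have h4 : ∑ k ∈ Finset.range (a + 1), (-1 : ℝ) ^ k * (a.choose k) *
          ((a + (M + 1) - k).choose (a + (r + 1))) =
          ∑ k ∈ Finset.range (a + 1 + 1), (-1 : ℝ) ^ k * (a.choose k) *
          ((a + (M + 1) - k).choose (a + (r + 1))) := by
        rw [Finset.sum_range_succ _ (a + 1)]; simp
      rw [h4, Finset.sum_range_succ', Finset.sum_range_succ' _ (a + 1), add_sub_right_comm,
        ← Finset.sum_sub_distrib]
      congr 1
      · refine Finset.sum_congr rfl fun k _ => ?_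
        rw [Nat.choose_succ_succ, show a + 1 + M - (k + 1) = a + M - k by omega,
          show a + (M + 1) - (k + 1) = a + M - k by omega, show a + 1 + r = a + (r + 1) by ring]
        push_cast
        ring
      · rw [show a + 1 + M - 0 = a + (M + 1) - 0 by omega, show a + 1 + r = a + (r + 1) by ring]
        simp
    rw [h3, h1, h2]
    ring

/-- The coefficients of `₂F₁(-a, -b; n + 1; X)`, which are nonnegative. -/
noncomputable def logCoeff (a b n k : ℕ) : ℝ :=
  (a.choose k) * (b.descFactorial k) * n.factorial / (n + k).factorial

lemma logCoeff_zero (a b n : ℕ) : logCoeff a b n 0 = 1 := by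
  simp [logCoeff, Nat.factorial_ne_zero]

lemma logCoeff_nonneg (a b n k : ℕ) : 0 ≤ logCoeff a b n k := by
  unfold logCoeff; positivity

lemma logCoeff_eq_zero (a b n k : ℕ) (h : a < k) : logCoeff a b n k = 0 := by
  simp [logCoeff, Nat.choose_eq_zero_of_lt h]

lemma logCoeff_succ (a b n k : ℕ) : (k + 1 : ℝ) * (k + 1 + n) * logCoeff a b n (k + 1) =
    (k - a) * (k - b) * logCoeff a b n k := by
  have h1 : (k + 1 : ℝ) * (a.choose (k + 1)) = (a - k) * a.choose k := by
    rcases Nat.lt_or_ge a k with h | h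
    · simp [Nat.choose_eq_zero_of_lt h, Nat.choose_eq_zero_of_lt (h.trans (Nat.lt_succ_self k))]
    · have := Nat.choose_succ_right_eq a k
      rw [← Nat.cast_sub h]
      have h' : ((a.choose (k + 1) * (k + 1) : ℕ) : ℝ) = ((a.choose k * (a - k) : ℕ) : ℝ) := by
        rw [this]
      push_cast at h' ⊢
      linear_combination h'
  have h2 : (b.descFactorial (k + 1) : ℝ) = (b - k) * b.descFactorial k := by
    rw [Nat.descFactorial_succ]
    rcases Nat.lt_or_ge b k with h | h
    · simp [Nat.descFactorial_eq_zero_iff_lt.2 h]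
    · push_cast [Nat.cast_sub h]; ring
  unfold logCoeff
  rw [h2, show n + (k + 1) = n + k + 1 by ring, Nat.factorial_succ]
  push_cast
  field_simp
  linear_combination (b.descFactorial k : ℝ) * (b - k) * (n + k + 1) * h1

/-- The `m`-th moment on `[0, 1]` of a polynomial. -/
noncomputable def unitMoment (m : ℕ) (K : Polynomial ℝ) : ℝ := ∫ y in (0 : ℝ)..1, y ^ m * K.eval y

lemma unitMoment_add (m : ℕ) (K L : Polynomial ℝ) :
    unitMoment m (K + L) = unitMoment m K + unitMoment m L := by
  unfold unitMoment
  rw [← intervalIntegral.integral_add (Continuous.intervalIntegrable (by fun_prop) _ _)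
    (Continuous.intervalIntegrable (by fun_prop) _ _)]
  simp [mul_add]

lemma unitMoment_C_mul (m : ℕ) (r : ℝ) (K : Polynomial ℝ) :
    unitMoment m (Polynomial.C r * K) = r * unitMoment m K := by
  unfold unitMoment
  rw [← intervalIntegral.integral_const_mul]
  congr 1; funext y; simp; ring

lemma unitMoment_sum {ι : Type*} (m : ℕ) (s : Finset ι) (K : ι → Polynomial ℝ) :
    unitMoment m (∑ i ∈ s, K i) = ∑ i ∈ s, unitMoment m (K i) := by
  classical
  induction s using Finset.induction_on with
  | empty => simp [unitMoment]
  | insert i s hi ih => rw [Finset.sum_insert hi, Finset.sum_insert hi, unitMoment_add, ih]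

lemma unitMoment_X_pow (m j : ℕ) : unitMoment m (Polynomial.X ^ j) = 1 / (m + j + 1) := by
  simp [unitMoment, ← pow_add, integral_pow]

/-- The generating function of the moments of a polynomial is, up to a polynomial, the polynomial
itself at the inverse point times a logarithm. -/
lemma hasSum_unitMoment (d : ℕ) (K : Polynomial ℝ) (hK : K.natDegree ≤ d) :
    ∃ Q : Polynomial ℝ, ∀ t : ℝ, 0 < t → t < 1 → HasSum (fun m => unitMoment m K * t ^ m)
      ((Q.eval t - t ^ d * K.eval t⁻¹ * Real.log (1 - t)) / t ^ (d + 1)) := by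
  refine Polynomial.induction_with_natDegree_le (fun K : Polynomial ℝ => ∃ Q : Polynomial ℝ,
    ∀ t : ℝ, 0 < t → t < 1 → HasSum (fun m => unitMoment m K * t ^ m)
      ((Q.eval t - t ^ d * K.eval t⁻¹ * Real.log (1 - t)) / t ^ (d + 1))) d ?_ ?_ ?_ K hK
  · exact ⟨0, fun t _ _ => by simp [unitMoment, hasSum_zero]⟩
  · intro j r hr hj
    refine ⟨Polynomial.C r *
      (-∑ i ∈ Finset.range j, Polynomial.C (1 / (i + 1 : ℝ)) * Polynomial.X ^ (d - j + i + 1)),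
      fun t ht ht1 => ?_⟩
    have h := Real.hasSum_pow_div_log_of_abs_lt_one (abs_lt.2 ⟨by linarith, ht1⟩)
    rw [← hasSum_nat_add_iff' j] at h
    have h2 := h.mul_left (r / t ^ (j + 1))
    convert! h2 using 1
    · funext m
      rw [unitMoment_C_mul, unitMoment_X_pow, show m + j + 1 = m + (j + 1) by ring, pow_add t m]
      push_cast
      field_simp
    · have hd : t ^ (d + 1) = t ^ (d - j) * t ^ (j + 1) := by
        rw [← pow_add]; congr 1; omega
      have hd' : t ^ d = t ^ (d - j) * t ^ j := by
        rw [← pow_add]; congr 1; omega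
      have hs : (∑ i ∈ Finset.range j, Polynomial.C (1 / (i + 1 : ℝ)) *
          Polynomial.X ^ (d - j + i + 1)).eval t =
          t ^ (d - j) * ∑ i ∈ Finset.range j, t ^ (i + 1) / (i + 1 : ℝ) := by
        rw [Polynomial.eval_finsetSum, Finset.mul_sum]
        refine Finset.sum_congr rfl fun i _ => ?_
        simp only [Polynomial.eval_mul, Polynomial.eval_C, Polynomial.eval_pow,
          Polynomial.eval_X, add_assoc, pow_add]
        ring
      rw [Polynomial.eval_mul, Polynomial.eval_neg, hs, hd, hd']
      simp only [Polynomial.eval_mul, Polynomial.eval_C, Polynomial.eval_pow, Polynomial.eval_X,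
        inv_pow]
      field_simp
      ring
  · intro f g _ _ hf' hg'
    obtain ⟨Q1, h1⟩ := hf'
    obtain ⟨Q2, h2⟩ := hg'
    refine ⟨Q1 + Q2, fun t ht ht1 => ?_⟩
    convert! (h1 t ht ht1).add (h2 t ht ht1) using 1
    · funext m; rw [unitMoment_add]; ring
    · simp; ring

/-- The polynomial whose moments are proportional to the coefficients of
`₂F₁(a + 1, b + 1; a + b + n + 2; X)`. -/
noncomputable def momentPoly (a b n : ℕ) : Polynomial ℝ :=
  ∑ k ∈ Finset.range (a + 1), Polynomial.C ((-1) ^ k * logCoeff a b n k) *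
    (Polynomial.X ^ (a + b - k) * (1 - Polynomial.X) ^ (n + k))

lemma natDegree_momentPoly_le (a b n : ℕ) : (momentPoly a b n).natDegree ≤ a + b + n := by
  refine Polynomial.natDegree_sum_le_of_forall_le _ _ fun k hk => ?_
  have hk' : k ≤ a := Nat.lt_succ_iff.1 (Finset.mem_range.1 hk)
  have h : (1 - Polynomial.X : Polynomial ℝ).natDegree ≤ 1 := by compute_degree
  refine (Polynomial.natDegree_C_mul_le _ _).trans (Polynomial.natDegree_mul_le.trans ?_)
  have h2 := Polynomial.natDegree_pow_le_of_le (n + k) h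
  rw [Polynomial.natDegree_X_pow]
  omega

lemma hypTerm_eq_unitMoment (a b n m : ℕ) :
    hypTerm (a + 1) (b + 1) ((a + b + n + 1 : ℕ) + 1) m =
      ((a + b + n + 1).factorial : ℝ) / (a.factorial * b.factorial * n.factorial) *
        unitMoment m (momentPoly a b n) := by
  have hterm : ∀ k ∈ Finset.range (a + 1),
      unitMoment m (Polynomial.C ((-1) ^ k * logCoeff a b n k) *
        (Polynomial.X ^ (a + b - k) * (1 - Polynomial.X) ^ (n + k))) =
      (n.factorial * b.factorial * (a + m).factorial : ℝ) / (a + b + n + 1 + m).factorial *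
        ((-1 : ℝ) ^ k * (a.choose k) * ((a + (b + m) - k).choose (a + m))) := by
    intro k hk
    have hk' : k ≤ a := Nat.lt_succ_iff.1 (Finset.mem_range.1 hk)
    rw [unitMoment_C_mul]
    have e : unitMoment m (Polynomial.X ^ (a + b - k) * (1 - Polynomial.X) ^ (n + k)) =
        ((m + (a + b - k)).factorial * (n + k).factorial : ℝ) / (a + b + n + 1 + m).factorial := by
      rw [show a + b + n + 1 + m = m + (a + b - k) + (n + k) + 1 by omega,
        ← integral_pow_mul_one_sub_pow]
      unfold unitMoment
      congr 1; funext y; simp [pow_add, mul_assoc]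
    rw [e, logCoeff]
    rcases Nat.lt_or_ge b k with h | h
    · rw [Nat.descFactorial_eq_zero_iff_lt.2 h,
        Nat.choose_eq_zero_of_lt (show a + (b + m) - k < a + m by omega)]
      simp
    · have h1 : ((b - k).factorial : ℝ) * b.descFactorial k = b.factorial := by
        exact_mod_cast Nat.factorial_mul_descFactorial h
      have h2 : (((a + (b + m) - k).choose (a + m)) * (a + m).factorial * (b - k).factorial : ℝ) =
          (m + (a + b - k)).factorial := by
        have := Nat.choose_mul_factorial_mul_factorial
          (show a + m ≤ a + (b + m) - k by omega)
        rw [show a + (b + m) - k - (a + m) = b - k by omega] at this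
        rw [show m + (a + b - k) = a + (b + m) - k by omega]
        exact_mod_cast this
      rw [← h1, ← h2]
      field_simp
  rw [momentPoly, unitMoment_sum, Finset.sum_congr rfl hterm, ← Finset.mul_sum,
    sum_neg_one_pow_choose_mul_choose, hypTerm_eq_factorial]
  have h3 : (((b + m).choose m) * m.factorial * b.factorial : ℝ) = (b + m).factorial := by
    have := Nat.choose_mul_factorial_mul_factorial (show m ≤ b + m by omega)
    rw [show b + m - m = b by omega] at this
    exact_mod_cast this
  rw [← h3]
  field_simp

lemma eval_inv_momentPoly (a b n : ℕ) (t : ℝ) (ht : t ≠ 0) :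
    t ^ (a + b + n) * (momentPoly a b n).eval t⁻¹ =
      (-1) ^ n * (1 - t) ^ n * ∑ k ∈ Finset.range (a + 1), logCoeff a b n k * (1 - t) ^ k := by
  rw [momentPoly, Polynomial.eval_finsetSum, Finset.mul_sum, Finset.mul_sum]
  refine Finset.sum_congr rfl fun k hk => ?_
  have hk' : k ≤ a := Nat.lt_succ_iff.1 (Finset.mem_range.1 hk)
  simp only [Polynomial.eval_mul, Polynomial.eval_C, Polynomial.eval_pow, Polynomial.eval_X,
    Polynomial.eval_sub, Polynomial.eval_one]
  have h1 : t ^ (a + b + n) = t ^ (a + b - k) * t ^ (n + k) := by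
    rw [← pow_add]; congr 1; omega
  have h2 : t ^ (n + k) * (1 - t⁻¹) ^ (n + k) = (-1) ^ (n + k) * (1 - t) ^ (n + k) := by
    rw [← mul_pow, ← mul_pow]; congr 1; field_simp; ring
  have h3 : t ^ (a + b - k) * t⁻¹ ^ (a + b - k) = 1 := by
    rw [← mul_pow, mul_inv_cancel₀ ht, one_pow]
  have h4 : ((-1 : ℝ) ^ k) * (-1) ^ k = 1 := by rw [← mul_pow]; simp
  calc _ = (-1) ^ k * logCoeff a b n k * (t ^ (a + b - k) * t⁻¹ ^ (a + b - k)) *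
        (t ^ (n + k) * (1 - t⁻¹) ^ (n + k)) := by rw [h1]; ring
    _ = logCoeff a b n k * ((-1) ^ k * (-1) ^ k) * ((-1) ^ n * (1 - t) ^ n * (1 - t) ^ k) := by
      rw [h2, h3, pow_add, pow_add]; ring
    _ = _ := by rw [h4]; ring

/-- Connection between the expansions at `0` and at `1`: on `(0, 1)` a hypergeometric series with
integer parameters is a rational function plus a polynomial times `log (1 - t)`, over a power
of `t`. -/
lemma exists_hasSum_hypTerm_log (a b n : ℕ) : ∃ Q : Polynomial ℝ, ∀ t : ℝ, 0 < t → t < 1 →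
    HasSum (fun m => hypTerm (a + 1) (b + 1) ((a + b + n + 1 : ℕ) + 1) m * t ^ m)
      ((Q.eval t - ((a + b + n + 1).factorial : ℝ) / (a.factorial * b.factorial * n.factorial) *
        ((-1) ^ n * (1 - t) ^ n * ∑ k ∈ Finset.range (a + 1), logCoeff a b n k * (1 - t) ^ k) *
          Real.log (1 - t)) / t ^ (a + b + n + 1)) := by
  obtain ⟨Q, hQ⟩ := hasSum_unitMoment _ _ (natDegree_momentPoly_le a b n)
  set r : ℝ := ((a + b + n + 1).factorial : ℝ) / (a.factorial * b.factorial * n.factorial) with hr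
  refine ⟨Polynomial.C r * Q, fun t ht ht1 => ?_⟩
  convert! (hQ t ht ht1).mul_left r using 1
  · funext m
    rw [hypTerm_eq_unitMoment]; ring
  · rw [← eval_inv_momentPoly a b n t ht.ne', Polynomial.eval_mul, Polynomial.eval_C]
    ring

/-! ### Expansion at `1` up to order `n` -/

/-- Bonferroni bounds for the remainder of the binomial expansion of `(1 - x) ^ m`. -/
lemma one_sub_pow_remainder_bounds (N : ℕ) (x : ℝ) (hx0 : 0 ≤ x) (hx1 : x ≤ 1) (m : ℕ) :
    0 ≤ (-1) ^ (N + 1) * ((1 - x) ^ m - ∑ k ∈ Finset.range (N + 1), (m.choose k : ℝ) * (-x) ^ k) ∧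
    (-1) ^ (N + 1) * ((1 - x) ^ m - ∑ k ∈ Finset.range (N + 1), (m.choose k : ℝ) * (-x) ^ k) ≤
      m.choose N * x ^ N ∧
    (-1) ^ (N + 1) * ((1 - x) ^ m - ∑ k ∈ Finset.range (N + 1), (m.choose k : ℝ) * (-x) ^ k) ≤
      m.choose (N + 1) * x ^ (N + 1) := by
  induction m with
  | zero =>
    have h : ∑ k ∈ Finset.range (N + 1), ((0 : ℕ).choose k : ℝ) * (-x) ^ k = 1 := by
      rw [Finset.sum_range_succ']; simp
    rw [h]
    simp
    positivity
  | succ m ih =>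
    have hrec : ∀ M : ℕ, ∑ k ∈ Finset.range (M + 1), ((m + 1).choose k : ℝ) * (-x) ^ k =
        (1 - x) * ∑ k ∈ Finset.range (M + 1), (m.choose k : ℝ) * (-x) ^ k -
          m.choose M * (-x) ^ (M + 1) := by
      intro M
      induction M with
      | zero => simp
      | succ M ihM =>
        rw [Finset.sum_range_succ, ihM, Finset.sum_range_succ _ (M + 1), Nat.choose_succ_succ]
        push_cast
        ring
    have e : (-1) ^ (N + 1) * ((1 - x) ^ (m + 1) -
        ∑ k ∈ Finset.range (N + 1), ((m + 1).choose k : ℝ) * (-x) ^ k) =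
        (1 - x) * ((-1) ^ (N + 1) * ((1 - x) ^ m -
          ∑ k ∈ Finset.range (N + 1), (m.choose k : ℝ) * (-x) ^ k)) +
        m.choose N * x ^ (N + 1) := by
      have h1 : ((-1 : ℝ) ^ (N + 1)) * (-x) ^ (N + 1) = x ^ (N + 1) := by
        rw [← mul_pow]; ring
      rw [hrec N, ← h1]
      ring
    obtain ⟨i1, i2, i3⟩ := ih
    rw [e]
    have hx : 0 ≤ 1 - x := by linarith
    refine ⟨by positivity, ?_, ?_⟩
    · have h1 := mul_le_mul_of_nonneg_left i2 hx
      have h2 : (m.choose N : ℝ) ≤ (m + 1).choose N := by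
        exact_mod_cast Nat.choose_le_choose N (Nat.le_succ m)
      have h3 := mul_le_mul_of_nonneg_right h2 (pow_nonneg hx0 N)
      have h4 : (1 - x) * (m.choose N * x ^ N) + m.choose N * x ^ (N + 1) =
          m.choose N * x ^ N := by ring
      linarith
    · have h1 : (1 - x) * ((-1) ^ (N + 1) * ((1 - x) ^ m -
          ∑ k ∈ Finset.range (N + 1), (m.choose k : ℝ) * (-x) ^ k)) ≤
          1 * ((-1) ^ (N + 1) * ((1 - x) ^ m -
          ∑ k ∈ Finset.range (N + 1), (m.choose k : ℝ) * (-x) ^ k)) :=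
        mul_le_mul_of_nonneg_right (by linarith) i1
      rw [Nat.choose_succ_succ]
      push_cast
      linarith

/-- A power series on `[0, 1]` with `N` summable binomial moments has a Taylor expansion of
order `N` at `1`. -/
lemma tendsto_powerSeries_taylor_one (T : ℕ → ℝ) (hT : ∀ m, 0 ≤ T m) (N : ℕ) (S : ℕ → ℝ)
    (hS : ∀ k ≤ N, HasSum (fun m => T m * (m.choose k : ℝ)) (S k)) (F : ℝ → ℝ)
    (hF : ∀ x ∈ Set.Ioo (0 : ℝ) 1, HasSum (fun m => T m * (1 - x) ^ m) (F x)) :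
    Tendsto (fun x => (F x - ∑ k ∈ Finset.range (N + 1), S k * (-x) ^ k) / x ^ N)
      (𝓝[>] 0) (𝓝 0) := by
  have hev : ∀ᶠ x : ℝ in 𝓝[>] 0, x ∈ Set.Ioo (0 : ℝ) 1 :=
    Ioo_mem_nhdsGT one_pos
  have habs : ∀ y : ℝ, |y| = |(-1) ^ (N + 1) * y| := fun y => by
    rw [abs_mul, abs_neg_one_pow, one_mul]
  have hlim : Tendsto (fun x : ℝ => ∑' m, T m * ((1 - x) ^ m -
      ∑ k ∈ Finset.range (N + 1), (m.choose k : ℝ) * (-x) ^ k) / x ^ N) (𝓝[>] 0)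
      (𝓝 (∑' _ : ℕ, (0 : ℝ))) := by
    refine tendsto_tsum_of_dominated_convergence (bound := fun m => T m * (m.choose N : ℝ))
      (hS N le_rfl).summable (fun m => ?_) ?_
    · have h0 : Tendsto (fun x : ℝ => T m * (m.choose (N + 1) : ℝ) * x) (𝓝[>] 0) (𝓝 0) := by
        have : Tendsto (fun x : ℝ => T m * (m.choose (N + 1) : ℝ) * x) (𝓝 0)
            (𝓝 (T m * (m.choose (N + 1) : ℝ) * 0)) := tendsto_id.const_mul _
        rw [mul_zero] at this
        exact this.mono_left nhdsWithin_le_nhds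
      refine squeeze_zero_norm' ?_ h0
      filter_upwards [hev] with x hx
      obtain ⟨i1, -, i3⟩ := one_sub_pow_remainder_bounds N x hx.1.le hx.2.le m
      have hxN : 0 < x ^ N := pow_pos hx.1 N
      rw [norm_div, norm_mul, Real.norm_of_nonneg (hT m), Real.norm_of_nonneg hxN.le,
        div_le_iff₀ hxN, mul_assoc, mul_assoc]
      refine mul_le_mul_of_nonneg_left ?_ (hT m)
      rw [Real.norm_eq_abs, habs, abs_of_nonneg i1]
      rwa [← pow_succ']
    · filter_upwards [hev] with x hx m
      obtain ⟨i1, i2, -⟩ := one_sub_pow_remainder_bounds N x hx.1.le hx.2.le m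
      have hxN : 0 < x ^ N := pow_pos hx.1 N
      rw [norm_div, norm_mul, Real.norm_of_nonneg (hT m), Real.norm_of_nonneg hxN.le,
        div_le_iff₀ hxN, mul_assoc]
      refine mul_le_mul_of_nonneg_left ?_ (hT m)
      rwa [Real.norm_eq_abs, habs, abs_of_nonneg i1]
  rw [tsum_zero] at hlim
  refine hlim.congr' ?_
  filter_upwards [hev] with x hx
  have h1 : HasSum (fun m => ∑ k ∈ Finset.range (N + 1), T m * (m.choose k : ℝ) * (-x) ^ k)
      (∑ k ∈ Finset.range (N + 1), S k * (-x) ^ k) :=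
    hasSum_sum fun k hk => (hS k (Nat.lt_succ_iff.1 (Finset.mem_range.1 hk))).mul_right _
  have h2 := ((hF x hx).sub h1).div_const (x ^ N)
  rw [← h2.tsum_eq]
  refine tsum_congr fun m => ?_
  rw [mul_sub, Finset.mul_sum]
  simp only [mul_assoc]

/-- The binomial moments of the coefficients of a hypergeometric series; up to sign these are its
Taylor coefficients at `1`, and each is an instance of Gauss's summation formula. -/
lemma hasSum_hypTerm_mul_choose (a b N k : ℕ) (hk : k ≤ N) :
    HasSum (fun m => hypTerm (a + 1) (b + 1) ((a + b + (N + 1) + 1 : ℕ) + 1) m *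
      (m.choose k : ℝ))
      (((a + k).factorial * (b + k).factorial * (a + b + (N + 1) + 1).factorial *
        (N - k).factorial : ℝ) /
        (a.factorial * b.factorial * k.factorial * (b + N + 1).factorial *
          (a + N + 1).factorial)) := by
  rw [← hasSum_nat_add_iff' k]
  have h0 : ∑ i ∈ Finset.range k, hypTerm (a + 1) (b + 1) ((a + b + (N + 1) + 1 : ℕ) + 1) i *
      (i.choose k : ℝ) = 0 :=
    Finset.sum_eq_zero fun i hi => by
      rw [Nat.choose_eq_zero_of_lt (Finset.mem_range.1 hi)]; simp
  rw [h0, sub_zero]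
  have h := (hasSum_hypTerm (b + k) (a + k + 1) (N - k)).mul_left
    (((a + k).factorial * (b + k).factorial * (a + b + (N + 1) + 1).factorial : ℝ) /
      (a.factorial * b.factorial * k.factorial * (a + b + (N + 1) + 1 + k).factorial))
  have e1 : a + k + 1 + (b + k) + (N - k) + 1 = a + b + (N + 1) + 1 + k := by omega
  have e2 : a + k + 1 + (b + k) + (N - k) + 1 = (a + k) + (b + k) + (N + 1 - k) + 1 := by omega
  have e3 : b + k + (N - k) + 1 = b + N + 1 := by omega
  have e4 : a + k + 1 + (N - k) = a + N + 1 := by omega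
  convert! h using 1
  · funext i
    have := hypTerm_eq_factorial (a + k) (b + k) (N + 1 - k) i
    rw [← e2, e1] at this
    rw [e1]
    push_cast at this ⊢
    rw [this]
    have h2 := hypTerm_eq_factorial a b (N + 1) (i + k)
    push_cast at h2
    rw [h2]
    have h3 : ((i + k).choose k * i.factorial * k.factorial : ℝ) = (i + k).factorial := by
      have := Nat.choose_mul_factorial_mul_factorial (show k ≤ i + k by omega)
      rw [Nat.add_sub_cancel] at this
      have h' : (((i + k).choose k * k.factorial * i.factorial : ℕ) : ℝ) =
        ((i + k).factorial : ℕ) := by rw [this]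
      push_cast at h'
      linear_combination h'
    have h4 : ((i + k).choose k : ℝ) ≠ 0 :=
      Nat.cast_ne_zero.2 (Nat.choose_pos (Nat.le_add_left k i)).ne'
    rw [← h3, show a + (i + k) = a + k + i by ring, show b + (i + k) = b + k + i by ring,
      show a + b + (N + 1) + 1 + (i + k) = a + b + (N + 1) + 1 + k + i by ring]
    field_simp
  · rw [e1, e3, e4]
    field_simp

open Asymptotics

/-! ### Expansions of rational functions with denominator a power of `1 - x` -/

/-- The expansion at `0` of `G(x) / (1 - x) ^ d`. -/
noncomputable def divOneSubPowSeries (G : Polynomial ℝ) (d : ℕ) : PowerSeries ℝ :=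
  (G : PowerSeries ℝ) * (PowerSeries.invOneSubPow ℝ d).val

lemma divOneSubPowSeries_isBigO (G : Polynomial ℝ) (d M : ℕ) :
    (fun x : ℝ => G.eval x / (1 - x) ^ d -
      ∑ k ∈ Finset.range M, PowerSeries.coeff k (divOneSubPowSeries G d) * x ^ k)
      =O[𝓝[>] 0] fun x => x ^ M := by
  set s := divOneSubPowSeries G d with hs
  set T := PowerSeries.trunc M s with hT
  have hdvd : Polynomial.X ^ M ∣ G - T * (1 - Polynomial.X) ^ d := by
    rw [Polynomial.X_pow_dvd_iff]
    have h1 : (PowerSeries.X : PowerSeries ℝ) ^ M ∣ s - (T : PowerSeries ℝ) := by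
      rw [PowerSeries.X_pow_dvd_iff]
      intro m hm
      simp [hT, PowerSeries.coeff_trunc, hm]
    have h2 : ((G - T * (1 - Polynomial.X) ^ d : Polynomial ℝ) : PowerSeries ℝ) =
        (s - (T : PowerSeries ℝ)) * (1 - PowerSeries.X) ^ d := by
      have h3 : (PowerSeries.invOneSubPow ℝ d).val * (1 - PowerSeries.X) ^ d = 1 := by
        rw [← PowerSeries.invOneSubPow_inv_eq_one_sub_pow]
        exact (PowerSeries.invOneSubPow ℝ d).val_inv
      rw [hs, divOneSubPowSeries, sub_mul, mul_assoc, h3]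
      push_cast
      ring
    have h4 := h1.mul_right ((1 - PowerSeries.X) ^ d)
    rw [← h2, PowerSeries.X_pow_dvd_iff] at h4
    intro m hm
    have h5 := h4 m hm
    rwa [Polynomial.coeff_coe] at h5
  obtain ⟨H, hH⟩ := hdvd
  have hcont : ContinuousAt (fun x : ℝ => H.eval x / (1 - x) ^ d) 0 := by
    refine ContinuousAt.div (by fun_prop) (by fun_prop) (by simp)
  have hO : (fun x : ℝ => x ^ M * (H.eval x / (1 - x) ^ d)) =O[𝓝[>] 0] fun x => x ^ M * 1 :=
    (isBigO_refl _ _).mul ((hcont.tendsto.isBigO_one ℝ).mono nhdsWithin_le_nhds)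
  simp only [mul_one] at hO
  refine hO.congr' ?_ EventuallyEq.rfl
  have hev : ∀ᶠ x : ℝ in 𝓝[>] 0, x ∈ Set.Ioo (0 : ℝ) 1 := Ioo_mem_nhdsGT one_pos
  filter_upwards [hev] with x hx
  have hx1 : (1 - x) ^ d ≠ 0 := pow_ne_zero _ (by linarith [hx.2])
  have e1 := congrArg (Polynomial.eval x) hH
  simp only [Polynomial.eval_sub, Polynomial.eval_mul, Polynomial.eval_pow, Polynomial.eval_one,
    Polynomial.eval_X] at e1
  have e2 : T.eval x = ∑ k ∈ Finset.range M, PowerSeries.coeff k s * x ^ k := by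
    rw [hT, Polynomial.eval, PowerSeries.eval₂_trunc_eq_sum_range]
    simp
  rw [← e2, div_sub' hx1, mul_div_assoc', ← e1]
  congr 1
  ring

/-- A polynomial of degree less than `M + 1` that is `o(x ^ M)` at `0` vanishes. -/
lemma coeff_eq_zero_of_tendsto_div (M : ℕ) (c : ℕ → ℝ)
    (h : Tendsto (fun x : ℝ => (∑ k ∈ Finset.range (M + 1), c k * x ^ k) / x ^ M)
      (𝓝[>] 0) (𝓝 0)) (k : ℕ) (hk : k ≤ M) : c k = 0 := by
  induction k using Nat.strong_induction_on with
  | _ k ih =>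
    have h1 : Tendsto (fun x : ℝ => (∑ k ∈ Finset.range (M + 1), c k * x ^ k) / x ^ M *
        x ^ (M - k)) (𝓝[>] 0) (𝓝 (0 * 0 ^ (M - k))) :=
      h.mul ((continuous_pow (M - k)).tendsto' 0 _ rfl |>.mono_left nhdsWithin_le_nhds)
    have h2 : Tendsto (fun x : ℝ => ∑ j ∈ Finset.range (M + 1 - k), c (k + j) * x ^ j)
        (𝓝[>] 0) (𝓝 (∑ j ∈ Finset.range (M + 1 - k), c (k + j) * 0 ^ j)) :=
      (Continuous.tendsto (by fun_prop) 0).mono_left nhdsWithin_le_nhds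
    have h3 := h2.congr' (f₂ := fun x : ℝ => (∑ k ∈ Finset.range (M + 1), c k * x ^ k) / x ^ M *
        x ^ (M - k)) (by
      filter_upwards [self_mem_nhdsWithin] with x hx
      have hx0 : x ≠ 0 := (Set.mem_Ioi.1 hx).ne'
      have e : ∑ j ∈ Finset.range (M + 1), c j * x ^ j =
          x ^ k * ∑ j ∈ Finset.range (M + 1 - k), c (k + j) * x ^ j := by
        rw [← Finset.sum_range_add_sum_Ico _ (show k ≤ M + 1 by omega),
          Finset.sum_eq_zero, zero_add, Finset.sum_Ico_eq_sum_range, Finset.mul_sum]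
        · exact Finset.sum_congr rfl fun j _ => by rw [pow_add]; ring
        · intro j hj
          have hj' := Finset.mem_range.1 hj
          rw [ih j hj' (by omega), zero_mul]
      have e2 : x ^ M = x ^ k * x ^ (M - k) := by rw [← pow_add]; congr 1; omega
      rw [e, e2]
      field_simp)
    have h4 := tendsto_nhds_unique h3 h1
    rw [show M + 1 - k = (M - k) + 1 by omega, Finset.sum_range_succ'] at h4
    simpa using h4

/-! ### The solution regular at the centre, near the boundary -/

/-- The sum on `[0, 1]` of the hypergeometric series with parameters
`(a + 1, b + 1; a + b + N + 3)`. -/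
noncomputable def hypSum (a b N : ℕ) (t : ℝ) : ℝ :=
  ∑' m, hypTerm (a + 1) (b + 1) ((a + b + (N + 1) + 1 : ℕ) + 1) m * t ^ m

lemma summable_hypTerm (a b N : ℕ) :
    Summable (hypTerm (a + 1) (b + 1) ((a + b + (N + 1) + 1 : ℕ) + 1)) := by
  simpa using (hasSum_hypTerm_mul_choose a b N 0 (Nat.zero_le _)).summable

lemma hypTerm_nat_nonneg (a b N m : ℕ) :
    0 ≤ hypTerm (a + 1) (b + 1) ((a + b + (N + 1) + 1 : ℕ) + 1) m :=
  hypTerm_nonneg _ _ _ (by positivity) (by positivity) (by positivity) _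

lemma hasSum_hypSum (a b N : ℕ) (t : ℝ) (ht : t ∈ Set.Icc (0 : ℝ) 1) :
    HasSum (fun m => hypTerm (a + 1) (b + 1) ((a + b + (N + 1) + 1 : ℕ) + 1) m * t ^ m)
      (hypSum a b N t) := by
  refine (Summable.of_nonneg_of_le (fun m => ?_) (fun m => ?_) (summable_hypTerm a b N)).hasSum
  · exact mul_nonneg (hypTerm_nat_nonneg a b N m) (pow_nonneg ht.1 m)
  · exact mul_le_of_le_one_right (hypTerm_nat_nonneg a b N m) (pow_le_one₀ ht.1 ht.2)

lemma continuousOn_hypSum (a b N : ℕ) : ContinuousOn (hypSum a b N) (Set.Icc 0 1) := by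
  refine continuousOn_tsum (fun m => by fun_prop) (summable_hypTerm a b N) fun m t ht => ?_
  rw [norm_mul, Real.norm_of_nonneg (hypTerm_nat_nonneg a b N m), norm_pow,
    Real.norm_of_nonneg ht.1]
  exact mul_le_of_le_one_right (hypTerm_nat_nonneg a b N m) (pow_le_one₀ ht.1 ht.2)

lemma hypSum_one (a b N : ℕ) : hypSum a b N 1 =
    ((a + b + (N + 1) + 1).factorial * N.factorial : ℝ) /
      ((b + N + 1).factorial * (a + N + 1).factorial) := by
  have h1 := hasSum_hypSum a b N 1 (by simp)
  have h2 := hasSum_hypTerm_mul_choose a b N 0 (Nat.zero_le _)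
  simp only [one_pow, mul_one, Nat.choose_zero_right, Nat.cast_one] at h1 h2
  rw [h1.unique h2]
  simp
  field_simp

lemma hypSum_one_pos (a b N : ℕ) : 0 < hypSum a b N 1 := by
  rw [hypSum_one]; positivity

/-- The polynomial `₂F₁(-a, -b; n + 1; X)`. -/
noncomputable def logPoly (a b n : ℕ) : Polynomial ℝ :=
  ∑ k ∈ Finset.range (a + 1), Polynomial.C (logCoeff a b n k) * Polynomial.X ^ k

lemma coeff_logPoly (a b n k : ℕ) : (logPoly a b n).coeff k = logCoeff a b n k := by
  rw [logPoly, Polynomial.finsetSum_coeff]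
  simp only [Polynomial.coeff_C_mul_X_pow]
  rw [Finset.sum_ite_eq]
  split_ifs with h
  · rfl
  · exact (logCoeff_eq_zero a b n k (by simpa using h)).symm

/-- The coefficient of the leading logarithmic term `x ^ (N + 1) * log x`. -/
noncomputable def logStrength (a b N : ℕ) : ℝ :=
  (-1) ^ N * ((a + N + 1).factorial * (b + N + 1).factorial : ℝ) /
    (a.factorial * b.factorial * (N + 1).factorial * N.factorial)

/-- The normalized hypergeometric function as a function of the distance `x` to the singular point:
a rational function plus a logarithmic term that starts at order `N + 1`. Up to that order the
rational part follows the hypergeometric recurrence with lower parameter `-N`. -/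
lemma exists_hypSum_log_expansion (a b N : ℕ) : ∃ Q : Polynomial ℝ,
    (∀ x ∈ Set.Ioo (0 : ℝ) 1, (1 - x) ^ (a + b + N + 2) *
      (hypSum a b N (1 - x) / hypSum a b N 1) =
        Q.eval x + logStrength a b N * x ^ (N + 1) * (logPoly a b (N + 1)).eval x * Real.log x) ∧
    PowerSeries.coeff 0 (divOneSubPowSeries Q (a + b + N + 2)) = 1 ∧
    ∀ k : ℕ, k + 1 < N + 1 → (k + 1 : ℝ) * (k + 1 - (N + 1 : ℕ)) *
      PowerSeries.coeff (k + 1) (divOneSubPowSeries Q (a + b + N + 2)) =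
        (k + (a + 1 : ℕ)) * (k + (b + 1 : ℕ)) *
          PowerSeries.coeff k (divOneSubPowSeries Q (a + b + N + 2)) := by
  obtain ⟨Q₀, hQ₀⟩ := exists_hasSum_hypTerm_log a b (N + 1)
  set F1 := hypSum a b N 1 with hF1
  have hF1pos : 0 < F1 := hypSum_one_pos a b N
  set Q : Polynomial ℝ := Polynomial.C (1 / F1) * Q₀.comp (1 - Polynomial.X) with hQ
  have hev : ∀ᶠ x : ℝ in 𝓝[>] 0, x ∈ Set.Ioo (0 : ℝ) 1 := Ioo_mem_nhdsGT one_pos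
  have hform : ∀ x ∈ Set.Ioo (0 : ℝ) 1, (1 - x) ^ (a + b + N + 2) *
      (hypSum a b N (1 - x) / F1) =
        Q.eval x + logStrength a b N * x ^ (N + 1) * (logPoly a b (N + 1)).eval x *
          Real.log x := by
    intro x hx
    have hx1 : 0 < 1 - x := by linarith [hx.2]
    have h1 := hQ₀ (1 - x) hx1 (by linarith [hx.1])
    have h2 := hasSum_hypSum a b N (1 - x) ⟨hx1.le, by linarith [hx.1]⟩
    rw [h2.unique h1, sub_sub_cancel, show a + b + (N + 1) + 1 = a + b + N + 2 by ring]
    have h3 : (logPoly a b (N + 1)).eval x =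
        ∑ k ∈ Finset.range (a + 1), logCoeff a b (N + 1) k * x ^ k := by
      simp [logPoly, Polynomial.eval_finsetSum]
    have h4 : Q.eval x = 1 / F1 * Q₀.eval (1 - x) := by simp [hQ]
    rw [h3, h4]
    have h5 : logStrength a b N = -((a + b + N + 2).factorial : ℝ) /
        (a.factorial * b.factorial * (N + 1).factorial) * (-1) ^ (N + 1) / F1 := by
      rw [hF1, hypSum_one, logStrength, show a + b + (N + 1) + 1 = a + b + N + 2 by ring]
      field_simp
      ring
    rw [h5]
    have := hF1pos.ne'
    have := (pow_pos hx1 (a + b + N + 2)).ne'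
    field_simp
    ring
  set s := divOneSubPowSeries Q (a + b + N + 2) with hs
  set S : ℕ → ℝ := fun k => ((a + k).factorial * (b + k).factorial *
    (a + b + (N + 1) + 1).factorial * (N - k).factorial : ℝ) /
    (a.factorial * b.factorial * k.factorial * (b + N + 1).factorial *
      (a + N + 1).factorial) with hS
  have hT := tendsto_powerSeries_taylor_one
    (hypTerm (a + 1) (b + 1) ((a + b + (N + 1) + 1 : ℕ) + 1)) (hypTerm_nat_nonneg a b N) N S
    (fun k hk => hasSum_hypTerm_mul_choose a b N k hk) (fun x => hypSum a b N (1 - x))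
    (fun x hx => hasSum_hypSum a b N (1 - x) ⟨by linarith [hx.2], by linarith [hx.1]⟩)
  -- the logarithmic term does not contribute up to order `N`
  have hlog : Tendsto (fun x : ℝ => logStrength a b N * (logPoly a b (N + 1)).eval x /
      (1 - x) ^ (a + b + N + 2) * (Real.log x * x)) (𝓝[>] 0) (𝓝 0) := by
    have h1 : ContinuousAt (fun x : ℝ => logStrength a b N * (logPoly a b (N + 1)).eval x /
      (1 - x) ^ (a + b + N + 2)) 0 :=
      ContinuousAt.div (by fun_prop) (by fun_prop) (by simp)
    have h2 := (h1.tendsto.mono_left nhdsWithin_le_nhds).mul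
      (by simpa only [Real.rpow_one] using tendsto_log_mul_rpow_nhdsGT_zero zero_lt_one)
    rwa [mul_zero] at h2
  have hser : Tendsto (fun x : ℝ => (Q.eval x / (1 - x) ^ (a + b + N + 2) -
      ∑ k ∈ Finset.range (N + 1), PowerSeries.coeff k s * x ^ k) / x ^ N) (𝓝[>] 0) (𝓝 0) := by
    have h1 := divOneSubPowSeries_isBigO Q (a + b + N + 2) (N + 1)
    have h2 : (fun x : ℝ => x ^ (N + 1)) =o[𝓝[>] 0] fun x => x ^ N :=
      (isLittleO_pow_pow (Nat.lt_succ_self N)).mono nhdsWithin_le_nhds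
    exact (h1.trans_isLittleO h2).tendsto_div_nhds_zero
  have hdiff : Tendsto (fun x : ℝ => (∑ k ∈ Finset.range (N + 1),
      (PowerSeries.coeff k s - (-1) ^ k * S k / F1) * x ^ k) / x ^ N) (𝓝[>] 0) (𝓝 0) := by
    have h1 := ((hT.div_const F1).sub hlog).sub hser
    simp only [zero_div, sub_zero] at h1
    refine h1.congr' ?_
    filter_upwards [hev] with x hx
    have hx1 : (1 - x) ^ (a + b + N + 2) ≠ 0 := pow_ne_zero _ (by linarith [hx.2])
    have hxN : x ^ N ≠ 0 := pow_ne_zero _ hx.1.ne'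
    have e1 : hypSum a b N (1 - x) = F1 * (Q.eval x + logStrength a b N * x ^ (N + 1) *
        (logPoly a b (N + 1)).eval x * Real.log x) / (1 - x) ^ (a + b + N + 2) := by
      rw [← hform x hx]
      field_simp
    have e2 : ∑ k ∈ Finset.range (N + 1), (PowerSeries.coeff k s - (-1) ^ k * S k / F1) * x ^ k =
        ∑ k ∈ Finset.range (N + 1), PowerSeries.coeff k s * x ^ k -
          (∑ k ∈ Finset.range (N + 1), S k * (-x) ^ k) / F1 := by
      rw [Finset.sum_div, ← Finset.sum_sub_distrib]
      refine Finset.sum_congr rfl fun k _ => ?_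
      rw [neg_pow]; ring
    rw [e2, e1]
    field_simp
    ring
  have hcoeff : ∀ k ≤ N, PowerSeries.coeff k s = (-1) ^ k * S k / F1 := fun k hk =>
    sub_eq_zero.1 (coeff_eq_zero_of_tendsto_div N _ hdiff k hk)
  refine ⟨Q, hform, ?_, fun k hk => ?_⟩
  · rw [hcoeff 0 (Nat.zero_le _), hF1, hypSum_one, hS]
    simp
    field_simp
  · rw [hcoeff k (by omega), hcoeff (k + 1) (by omega)]
    obtain ⟨j, rfl⟩ := Nat.exists_eq_add_of_le (show k + 1 ≤ N by omega)
    simp only [hS]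
    rw [show k + 1 + j - (k + 1) = j by omega, show k + 1 + j - k = j + 1 by omega,
      ← add_assoc, ← add_assoc, Nat.factorial_succ j, Nat.factorial_succ k,
      Nat.factorial_succ (a + k), Nat.factorial_succ (b + k)]
    push_cast
    field_simp
    ring

/-! ### Meromorphic continuation of Mellin transforms on `(0, 1]` -/

/-- The meromorphic continuation in `s` of `∫₀¹ x ^ s * x ^ k * (a + b * log x + c * (log x) ^ 2) dx`,
with the junk value `0` at its pole `-k - 1`. -/
noncomputable def mellinPole (a b c : ℂ) (k : ℕ) (s : ℂ) : ℂ :=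
  a / (s + k + 1) - b / (s + k + 1) ^ 2 + 2 * c / (s + k + 1) ^ 3

lemma locallyIntegrableOn_indicator_Ioc {g : ℝ → ℂ} (hg : ContinuousOn g (Set.Ioc 0 1)) :
    MeasureTheory.LocallyIntegrableOn ((Set.Ioc 0 1).indicator g) (Set.Ioi 0) := by
  rw [MeasureTheory.locallyIntegrableOn_iff isOpen_Ioi.isLocallyClosed]
  intro K hK hKc
  rw [MeasureTheory.integrableOn_indicator_iff measurableSet_Ioc]
  have h1 : Set.Ioc (0 : ℝ) 1 ∩ K = K ∩ Set.Iic 1 := by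
    ext x
    constructor
    · rintro ⟨h, h'⟩; exact ⟨h', h.2⟩
    · rintro ⟨h, h'⟩; exact ⟨⟨hK h, h'⟩, h⟩
  rw [h1]
  refine ContinuousOn.integrableOn_compact (hKc.inter_right isClosed_Iic) (hg.mono ?_)
  rintro x ⟨h, h'⟩
  exact ⟨hK h, h'⟩

lemma indicator_Ioc_isBigO_atTop (g : ℝ → ℂ) (u : ℝ → ℝ) :
    (Set.Ioc (0 : ℝ) 1).indicator g =O[atTop] u := by
  refine (isBigO_zero u atTop).congr' ?_ EventuallyEq.rfl
  filter_upwards [eventually_gt_atTop 1] with x hx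
  rw [Set.indicator_of_notMem]
  exact fun h => absurd h.2 (not_le.2 hx)

lemma indicator_Ioc_eventuallyEq (g : ℝ → ℂ) : (Set.Ioc (0 : ℝ) 1).indicator g =ᶠ[𝓝[>] 0] g := by
  filter_upwards [Ioo_mem_nhdsGT (zero_lt_one' ℝ)] with x hx
  rw [Set.indicator_of_mem (Set.Ioo_subset_Ioc_self hx)]

/-- On `(0, 1]` differentiating the Mellin transform inserts a factor `log x` under the integral. -/
lemma mellin_indicator_log {g : ℝ → ℂ} (hg : ContinuousOn g (Set.Ioc 0 1)) {r : ℝ}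
    (hO : g =O[𝓝[>] 0] fun x : ℝ => x ^ r) {s : ℂ} (hs : -r < s.re) :
    MellinConvergent ((Set.Ioc 0 1).indicator g) s ∧
    MellinConvergent ((Set.Ioc 0 1).indicator fun x => (Real.log x : ℂ) * g x) s ∧
      HasDerivAt (mellin ((Set.Ioc 0 1).indicator g))
        (mellin ((Set.Ioc 0 1).indicator fun x => (Real.log x : ℂ) * g x) s) s := by
  have hO' : (Set.Ioc (0 : ℝ) 1).indicator g =O[𝓝[>] 0] fun x : ℝ => x ^ (-(-r)) := by
    rw [neg_neg]; exact hO.congr' (indicator_Ioc_eventuallyEq g).symm EventuallyEq.rfl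
  have e : (fun t : ℝ => Real.log t • (Set.Ioc (0 : ℝ) 1).indicator g t) =
      (Set.Ioc 0 1).indicator fun x => (Real.log x : ℂ) * g x := by
    funext t
    by_cases ht : t ∈ Set.Ioc (0 : ℝ) 1
    · simp [Set.indicator_of_mem ht]
    · simp [Set.indicator_of_notMem ht]
  rw [← e]
  refine ⟨?_, mellin_hasDerivAt_of_isBigO_rpow (a := s.re + 1)
    (locallyIntegrableOn_indicator_Ioc hg) (indicator_Ioc_isBigO_atTop _ _) (by linarith) hO' hs⟩
  exact mellinConvergent_of_isBigO_rpow (a := s.re + 1) (locallyIntegrableOn_indicator_Ioc hg)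
    (indicator_Ioc_isBigO_atTop _ _) (by linarith) hO' hs

lemma continuousOn_ofReal_log : ContinuousOn (fun x : ℝ => (Real.log x : ℂ)) (Set.Ioc 0 1) :=
  Complex.continuous_ofReal.comp_continuousOn
    (Real.continuousOn_log.mono fun _ hx => ne_of_gt hx.1)

lemma ofReal_log_mul_isBigO {g : ℝ → ℂ} {r r' : ℝ} (hr : r' < r)
    (hO : g =O[𝓝[>] 0] fun x : ℝ => x ^ r) :
    (fun x : ℝ => (Real.log x : ℂ) * g x) =O[𝓝[>] 0] fun x : ℝ => x ^ r' := by
  have h1 : (fun x : ℝ => (Real.log x : ℂ)) =O[𝓝[>] 0] fun x : ℝ => x ^ (r' - r) :=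
    (isLittleO_log_rpow_nhdsGT_zero (by linarith : r' - r < 0)).isBigO.norm_left.congr_left
      (fun x => by simp) |>.of_norm_left
  refine (h1.mul hO).congr' EventuallyEq.rfl ?_
  filter_upwards [self_mem_nhdsWithin] with x hx
  rw [← Real.rpow_add hx]
  congr 1; ring

lemma hasMellin_pow_log (a b c : ℂ) (k : ℕ) {s : ℂ} (hs : -(k : ℝ) - 1 < s.re) :
    HasMellin ((Set.Ioc 0 1).indicator fun x : ℝ =>
      (x : ℂ) ^ k * (a + b * Real.log x + c * (Real.log x : ℂ) ^ 2)) (s + 1)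
      (mellinPole a b c k s) := by
  have hc0 : ContinuousOn (fun x : ℝ => (x : ℂ) ^ k) (Set.Ioc 0 1) := by fun_prop
  have hc1 := continuousOn_ofReal_log.mul hc0
  have hO0 : (fun x : ℝ => (x : ℂ) ^ k) =O[𝓝[>] 0] fun x : ℝ => x ^ (k : ℝ) := by
    simp only [Real.rpow_natCast]
    exact (isBigO_refl (fun x : ℝ => x ^ k) _).norm_left.congr_left
      (fun x => by simp) |>.of_norm_left
  have hre : ∀ z : ℂ, -(k : ℝ) < z.re → z + k ≠ 0 := fun z hz h0 => by
    have := congrArg Complex.re h0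
    simp at this
    linarith
  have hopen : ∀ z : ℂ, -(k : ℝ) < z.re → ∀ᶠ w in 𝓝 z, -(k : ℝ) < w.re := fun z hz =>
    (isOpen_lt continuous_const Complex.continuous_re).mem_nhds hz
  have hm0 : ∀ z : ℂ, -(k : ℝ) < z.re →
      mellin ((Set.Ioc 0 1).indicator fun x : ℝ => (x : ℂ) ^ k) z = 1 / (z + k) := fun z hz => by
    have := (hasMellin_cpow_Ioc (k : ℂ) (s := z) (by simp; linarith)).2
    simpa only [Complex.cpow_natCast] using this
  have hm1 : ∀ z : ℂ, -(k : ℝ) < z.re →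
      mellin ((Set.Ioc 0 1).indicator fun x : ℝ => (Real.log x : ℂ) * (x : ℂ) ^ k) z =
        -1 / (z + k) ^ 2 := fun z hz => by
    have h1 := (mellin_indicator_log hc0 hO0 hz).2.2
    have h2 : HasDerivAt (fun w : ℂ => 1 / (w + k)) (-1 / (z + k) ^ 2) z := by
      have := ((hasDerivAt_id z).add_const (k : ℂ)).inv (hre z hz)
      simpa [one_div] using! this
    exact h1.unique (h2.congr_of_eventuallyEq ((hopen z hz).mono hm0))
  have hm2 : ∀ z : ℂ, -(k : ℝ) < z.re →
      MellinConvergent ((Set.Ioc 0 1).indicator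
        fun x : ℝ => (Real.log x : ℂ) * ((Real.log x : ℂ) * (x : ℂ) ^ k)) z ∧
      mellin ((Set.Ioc 0 1).indicator
        fun x : ℝ => (Real.log x : ℂ) * ((Real.log x : ℂ) * (x : ℂ) ^ k)) z =
        2 / (z + k) ^ 3 := fun z hz => by
    obtain ⟨r, hr1, hr2⟩ := exists_between (show -z.re < k by linarith)
    obtain ⟨-, h1, h2⟩ := mellin_indicator_log hc1 (ofReal_log_mul_isBigO hr2 hO0)
      (s := z) (by linarith)
    refine ⟨h1, h2.unique (HasDerivAt.congr_of_eventuallyEq ?_ ((hopen z hz).mono hm1))⟩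
    have := ((((hasDerivAt_id z).add_const (k : ℂ)).pow 2).inv (pow_ne_zero 2 (hre z hz))).neg
    have hne := hre z hz
    convert! this using 1
    · funext w; simp [neg_div]
    · simp; field_simp
  have hz : -(k : ℝ) < (s + 1).re := by simp; linarith
  obtain ⟨c0, c1, -⟩ := mellin_indicator_log hc0 hO0 hz
  obtain ⟨c2, v2⟩ := hm2 _ hz
  have h0 := hasMellin_const_smul c0 a
  have h1 := hasMellin_const_smul c1 b
  have h2 := hasMellin_const_smul c2 c
  have h01 := hasMellin_add h0.1 h1.1
  have h012 := hasMellin_add h01.1 h2.1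
  rw [h01.2, h0.2, h1.2, h2.2, hm0 _ hz, hm1 _ hz, v2] at h012
  convert! h012 using 1
  · funext x
    by_cases hx : x ∈ Set.Ioc (0 : ℝ) 1
    · simp only [Set.indicator_of_mem hx, smul_eq_mul]; ring
    · simp [Set.indicator_of_notMem hx]
  · rw [mellinPole, show s + k + 1 = s + 1 + k by ring]
    simp only [smul_eq_mul]
    ring

/-- A function on `(0, 1]` with an asymptotic expansion at `0` in terms `x ^ k * (log x) ^ i`,
`i ≤ 2`, has a Mellin transform that continues meromorphically to the whole plane. Each term of the
expansion contributes the principal part of its own transform. -/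
theorem exists_mellin_continuation (h A B C : ℝ → ℂ) (a b c : ℕ → ℂ)
    (hcont : ContinuousOn h (Set.Ioc 0 1))
    (hexp : ∀ x ∈ Set.Ioo (0 : ℝ) 1, h x = A x + B x * Real.log x + C x * (Real.log x : ℂ) ^ 2)
    (hA : ∀ N : ℕ, (fun x : ℝ => A x - ∑ k ∈ Finset.range N, a k * (x : ℂ) ^ k)
      =O[𝓝[>] 0] fun x : ℝ => x ^ N)
    (hB : ∀ N : ℕ, (fun x : ℝ => B x - ∑ k ∈ Finset.range N, b k * (x : ℂ) ^ k)
      =O[𝓝[>] 0] fun x : ℝ => x ^ N)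
    (hC : ∀ N : ℕ, (fun x : ℝ => C x - ∑ k ∈ Finset.range N, c k * (x : ℂ) ^ k)
      =O[𝓝[>] 0] fun x : ℝ => x ^ N) :
    ∃ M : ℂ → ℂ,
      (∀ s : ℂ, -1 < s.re → M s = mellin ((Set.Ioc 0 1).indicator h) (s + 1)) ∧
      ∀ N : ℕ, ∃ g : ℂ → ℂ, ∀ s : ℂ, -(N : ℝ) - 1 < s.re → AnalyticAt ℂ g s ∧
        M s = ∑ k ∈ Finset.range N, mellinPole (a k) (b k) (c k) k s + g s := by
  set term : ℕ → ℝ → ℂ := fun k x =>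
    (x : ℂ) ^ k * (a k + b k * Real.log x + c k * (Real.log x : ℂ) ^ 2) with hterm
  set rem : ℕ → ℝ → ℂ := fun N x => h x - ∑ k ∈ Finset.range N, term k x with hrem
  have htc : ∀ k, ContinuousOn (term k) (Set.Ioc 0 1) := fun k => by
    have := continuousOn_ofReal_log
    have h2 : ContinuousOn (fun x : ℝ => (x : ℂ) ^ k) (Set.Ioc 0 1) := by fun_prop
    exact h2.mul ((continuousOn_const.add (continuousOn_const.mul this)).add
      (continuousOn_const.mul (this.pow 2)))
  have hrc : ∀ N, ContinuousOn (rem N) (Set.Ioc 0 1) := fun N =>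
    hcont.sub (continuousOn_finsetSum _ fun k _ => htc k)
  have hrO : ∀ (N : ℕ) (r : ℝ), r < N → rem N =O[𝓝[>] 0] fun x : ℝ => x ^ r := by
    intro N r hr
    obtain ⟨r1, hr1, hr1'⟩ := exists_between hr
    obtain ⟨r2, hr2, hr2'⟩ := exists_between hr1'
    have up : ∀ r', r' < (N : ℝ) → ∀ u : ℝ → ℂ, (u =O[𝓝[>] 0] fun x : ℝ => x ^ N) →
        u =O[𝓝[>] 0] fun x : ℝ => x ^ r' := by
      intro r' hr' u hu
      refine hu.trans (IsBigO.of_bound 1 ?_)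
      filter_upwards [Ioo_mem_nhdsGT (zero_lt_one' ℝ)] with x hx
      rw [one_mul, Real.norm_of_nonneg (pow_nonneg hx.1.le _),
        Real.norm_of_nonneg (Real.rpow_nonneg hx.1.le _), ← Real.rpow_natCast]
      exact Real.rpow_le_rpow_of_exponent_ge hx.1 hx.2.le hr'.le
    have o1 := up r hr _ (hA N)
    have o2 := ofReal_log_mul_isBigO hr1 (up r1 hr1' _ (hB N))
    have o3 := ofReal_log_mul_isBigO hr1 (ofReal_log_mul_isBigO hr2 (up r2 hr2' _ (hC N)))
    refine ((o1.add o2).add o3).congr' ?_ EventuallyEq.rfl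
    filter_upwards [Ioo_mem_nhdsGT (zero_lt_one' ℝ)] with x hx
    simp only [hrem, hterm, hexp x hx, mul_add, Finset.sum_add_distrib]
    simp only [mul_sub, Finset.mul_sum]
    have e1 : ∀ k, (x : ℂ) ^ k * a k = a k * (x : ℂ) ^ k := fun k => by ring
    have e2 : ∀ k, (x : ℂ) ^ k * (b k * Real.log x) = Real.log x * (b k * (x : ℂ) ^ k) :=
      fun k => by ring
    have e3 : ∀ k, (x : ℂ) ^ k * (c k * (Real.log x : ℂ) ^ 2) =
      Real.log x * (Real.log x * (c k * (x : ℂ) ^ k)) := fun k => by ring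
    simp only [e1, e2, e3]
    ring
  set G : ℕ → ℂ → ℂ := fun N s => mellin ((Set.Ioc 0 1).indicator (rem N)) (s + 1) with hG
  have hconv : ∀ (N : ℕ) (s : ℂ), -(N : ℝ) - 1 < s.re →
      MellinConvergent ((Set.Ioc 0 1).indicator (rem N)) (s + 1) ∧ DifferentiableAt ℂ (G N) s := by
    intro N s hs
    obtain ⟨r, hr1, hr2⟩ := exists_between (show -s.re - 1 < N by linarith)
    obtain ⟨h1, -, h2⟩ := mellin_indicator_log (hrc N) (hrO N r hr2) (s := s + 1)
      (by simp; linarith)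
    exact ⟨h1, DifferentiableAt.comp (g := mellin _) (f := fun z : ℂ => z + 1) s
      h2.differentiableAt (by fun_prop)⟩
  have hGan : ∀ (N : ℕ) (s : ℂ), -(N : ℝ) - 1 < s.re → AnalyticAt ℂ (G N) s := by
    intro N s hs
    have ho : IsOpen {z : ℂ | -(N : ℝ) - 1 < z.re} :=
      isOpen_lt continuous_const Complex.continuous_re
    exact DifferentiableOn.analyticAt (fun z hz => (hconv N z hz).2.differentiableWithinAt)
      (ho.mem_nhds hs)
  set E : ℕ → ℂ → ℂ := fun N s =>
    ∑ k ∈ Finset.range N, mellinPole (a k) (b k) (c k) k s + G N s with hE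
  have hstep : ∀ (N : ℕ) (s : ℂ), -(N : ℝ) - 1 < s.re → E (N + 1) s = E N s := by
    intro N s hs
    have h1 := (hconv (N + 1) s (by push_cast; linarith)).1
    have h2 := hasMellin_pow_log (a N) (b N) (c N) N hs
    have h3 := hasMellin_add h1 h2.1
    have e : (Set.Ioc (0 : ℝ) 1).indicator (rem N) = fun x =>
        (Set.Ioc (0 : ℝ) 1).indicator (rem (N + 1)) x +
          (Set.Ioc (0 : ℝ) 1).indicator (term N) x := by
      funext x
      by_cases hx : x ∈ Set.Ioc (0 : ℝ) 1
      · simp only [Set.indicator_of_mem hx, hrem, Finset.sum_range_succ]; ring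
      · simp [Set.indicator_of_notMem hx]
    have h4 : G N s = G (N + 1) s + mellinPole (a N) (b N) (c N) N s := by
      simp only [hG, e]
      rw [h3.2, h2.2]
    simp only [hE, h4, Finset.sum_range_succ]
    ring
  have hsteps : ∀ (N j : ℕ) (s : ℂ), -(N : ℝ) - 1 < s.re → E (N + j) s = E N s := by
    intro N j s hs
    induction j with
    | zero => rfl
    | succ j ih =>
      rw [← add_assoc, hstep (N + j) s (by push_cast; linarith [Nat.cast_nonneg (α := ℝ) j]), ih]
  -- `E N s` does not depend on `N` once its integral converges, so `N` may be chosen from `s`.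
  have hany : ∀ (N : ℕ) (s : ℂ), -(N : ℝ) - 1 < s.re → E ⌈-s.re⌉₊ s = E N s := by
    intro N s hs
    have h1 : -((⌈-s.re⌉₊ : ℕ) : ℝ) - 1 < s.re := by linarith [Nat.le_ceil (-s.re)]
    rw [← hsteps _ N s h1, add_comm, hsteps N _ s hs]
  refine ⟨fun s => E ⌈-s.re⌉₊ s, fun s hs => ?_,
    fun N => ⟨G N, fun s hs => ⟨hGan N s hs, hany N s hs⟩⟩⟩
  refine (hany 0 s (by simpa using hs)).trans ?_
  simp [hE, hG, hrem]

/-! ### The coefficients as Mellin transforms -/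

/-- The weight `(1 - x) ^ (p + q + n - 1)` times the square of the normalized hypergeometric
function at `1 - x`, for `p = a + 1`, `q = b + 1`, `n = N + 1`. -/
noncomputable def mhDensity (a b N : ℕ) (x : ℝ) : ℂ :=
  (((1 - x) ^ (a + b + N + 2) * (hypSum a b N (1 - x) / hypSum a b N 1) ^ 2 : ℝ) : ℂ)

lemma mhRadial_eq_hypSum (a b N : ℕ) (r : ℝ) :
    mhRadial (N + 1) (a + 1) (b + 1) r =
      r ^ (a + b + 2) * hypSum a b N (r ^ 2) / hypSum a b N 1 := by
  have h : ∀ t : ℝ, ordinaryHypergeometric (((a + 1 : ℕ) : ℝ)) ((b + 1 : ℕ) : ℝ)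
      (((a + 1 : ℕ) : ℝ) + ((b + 1 : ℕ) : ℝ) + ((N + 1 : ℕ) : ℝ)) t = hypSum a b N t := by
    intro t
    rw [ordinaryHypergeometric_eq_tsum, hypSum]
    refine tsum_congr fun m => ?_
    rw [hypTerm, show (((a + 1 : ℕ) : ℝ) + ((b + 1 : ℕ) : ℝ) + ((N + 1 : ℕ) : ℝ)) =
      ((a + b + (N + 1) + 1 : ℕ) : ℝ) + 1 by push_cast; ring]
    push_cast
    rw [smul_eq_mul, div_eq_mul_inv, mul_inv]
    ring
  rw [mhRadial, h, h, show a + 1 + (b + 1) = a + b + 2 by ring]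

lemma mellin_indicator_Ioc (h : ℝ → ℂ) (s : ℂ) :
    mellin ((Set.Ioc 0 1).indicator h) (s + 1) = ∫ x in Set.Ioo (0 : ℝ) 1, (x : ℂ) ^ s * h x := by
  have e : ∀ t : ℝ, (t : ℂ) ^ (s + 1 - 1) • (Set.Ioc (0 : ℝ) 1).indicator h t =
      (Set.Ioc (0 : ℝ) 1).indicator (fun x => (x : ℂ) ^ s * h x) t := by
    intro t
    by_cases ht : t ∈ Set.Ioc (0 : ℝ) 1
    · simp [Set.indicator_of_mem ht]
    · simp [Set.indicator_of_notMem ht]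
  simp only [mellin, e]
  rw [MeasureTheory.setIntegral_indicator measurableSet_Ioc,
    Set.inter_eq_right.2 Set.Ioc_subset_Ioi_self, MeasureTheory.integral_Ioc_eq_integral_Ioo]

/-- The substitution `x = 1 - r ^ 2`. -/
lemma setIntegral_comp_one_sub_sq (g : ℝ → ℂ) :
    ∫ x in Set.Ioo (0 : ℝ) 1, g x = ∫ r in Set.Ioo (0 : ℝ) 1, (2 * r : ℂ) * g (1 - r ^ 2) := by
  have him : (fun r : ℝ => 1 - r ^ 2) '' Set.Ioo 0 1 = Set.Ioo 0 1 := by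
    ext x
    constructor
    · rintro ⟨r, hr, rfl⟩
      constructor <;> simp only <;> nlinarith [hr.1, hr.2]
    · intro hx
      have h1 : 0 < 1 - x := by linarith [hx.2]
      refine ⟨√(1 - x), ⟨Real.sqrt_pos.2 h1, ?_⟩, ?_⟩
      · rw [Real.sqrt_lt' one_pos]; linarith [hx.1]
      · simp only [Real.sq_sqrt h1.le]; ring
  have hinj : Set.InjOn (fun r : ℝ => 1 - r ^ 2) (Set.Ioo 0 1) := by
    intro r hr r' hr' h
    have h' : r ^ 2 = r' ^ 2 := by simp only at h; linarith
    exact (pow_left_inj₀ hr.1.le hr'.1.le two_ne_zero).1 h'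
  have h := MeasureTheory.integral_image_eq_integral_abs_deriv_smul
    (f' := fun r => -(2 * r)) measurableSet_Ioo (fun r _ => by
      have := ((hasDerivAt_pow 2 r).const_sub 1).hasDerivWithinAt (s := Set.Ioo (0 : ℝ) 1)
      simpa using! this) hinj g
  rw [him] at h
  rw [h]
  refine MeasureTheory.setIntegral_congr_fun measurableSet_Ioo fun r hr => ?_
  rw [abs_neg, abs_of_pos (by linarith [hr.1] : 0 < 2 * r), Complex.real_smul]
  push_cast
  ring

lemma Gamma_nat_add_eq_prod_mul (n : ℕ) (s : ℂ) (hs : -1 < s.re) :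
    Complex.Gamma ((n : ℂ) + s + 1) =
      (∏ i ∈ Finset.range n, (s + 1 + i)) * Complex.Gamma (s + 1) := by
  induction n with
  | zero => simp
  | succ n ih =>
    have hne : (n : ℂ) + s + 1 ≠ 0 := by
      intro h
      have := congrArg Complex.re h
      simp at this
      linarith [Nat.cast_nonneg (α := ℝ) n]
    rw [show ((n + 1 : ℕ) : ℂ) + s + 1 = ((n : ℂ) + s + 1) + 1 by push_cast; ring,
      Complex.Gamma_add_one _ hne, ih, Finset.prod_range_succ]
    ring

lemma mhCoeff_eq_mellin (a b N : ℕ) (s : ℂ) (hs : -1 < s.re) :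
    mhCoeff (N + 1) (a + 1) (b + 1) s =
      (∏ i ∈ Finset.range (N + 1), (s + 1 + i)) / Complex.Gamma ((N + 1 : ℕ) : ℂ) *
        mellin ((Set.Ioc 0 1).indicator (mhDensity a b N)) (s + 1) := by
  have hpi : (Real.pi : ℂ) ^ (N + 1) ≠ 0 :=
    pow_ne_zero _ (Complex.ofReal_ne_zero.2 Real.pi_ne_zero)
  have hG : Complex.Gamma (s + 1) ≠ 0 :=
    Complex.Gamma_ne_zero_of_re_pos (by simp; linarith)
  rw [mhCoeff, Gamma_nat_add_eq_prod_mul _ _ hs, mellin_indicator_Ioc,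
    setIntegral_comp_one_sub_sq, intervalIntegral.integral_of_le zero_le_one,
    MeasureTheory.integral_Ioc_eq_integral_Ioo]
  have hint : ∀ r : ℝ, ((mhRadial (N + 1) (a + 1) (b + 1) r : ℝ) : ℂ) ^ 2 *
      (2 * (Real.pi : ℂ) ^ (N + 1) / Complex.Gamma ((N + 1 : ℕ) : ℂ)) *
        ((1 - r ^ 2 : ℝ) : ℂ) ^ s * (r : ℂ) ^ (2 * (N + 1) - 1) =
      (Real.pi : ℂ) ^ (N + 1) / Complex.Gamma ((N + 1 : ℕ) : ℂ) *
        ((2 * r : ℂ) * (((1 - r ^ 2 : ℝ) : ℂ) ^ s * mhDensity a b N (1 - r ^ 2))) := by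
    intro r
    rw [mhRadial_eq_hypSum, mhDensity, sub_sub_cancel, show 2 * (N + 1) - 1 = 2 * N + 1 by omega]
    push_cast
    ring
  simp only [hint]
  rw [MeasureTheory.integral_const_mul]
  field_simp

/-! ### Orders of the poles -/

lemma mellinPole_analyticAt (a b c : ℂ) (k : ℕ) (s : ℂ) (hs : s ≠ -((k : ℂ) + 1)) :
    AnalyticAt ℂ (mellinPole a b c k) s := by
  have h : s + k + 1 ≠ 0 := fun h => hs (by linear_combination h)
  unfold mellinPole
  refine AnalyticAt.add (AnalyticAt.sub ?_ ?_) ?_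
  · exact AnalyticAt.div (by fun_prop) (by fun_prop) h
  · exact AnalyticAt.div (by fun_prop) (by fun_prop) (pow_ne_zero _ h)
  · exact AnalyticAt.div (by fun_prop) (by fun_prop) (pow_ne_zero _ h)

lemma eventuallyEq_zpow_smul (f φ : ℂ → ℂ) (s₀ : ℂ) (d : ℕ)
    (hf : ∀ᶠ s in 𝓝[≠] s₀, (s - s₀) ^ d * f s = φ s) :
    f =ᶠ[𝓝[≠] s₀] fun s => (s - s₀) ^ (-(d : ℤ)) • φ s := by
  filter_upwards [hf, self_mem_nhdsWithin] with s hs hne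
  have : (s - s₀) ^ d ≠ 0 := pow_ne_zero _ (sub_ne_zero.2 hne)
  rw [← hs, zpow_neg, zpow_natCast, smul_eq_mul, inv_mul_cancel_left₀ this]

lemma meromorphicAt_of_pow_mul (f φ : ℂ → ℂ) (s₀ : ℂ) (d : ℕ) (hφ : AnalyticAt ℂ φ s₀)
    (hf : ∀ᶠ s in 𝓝[≠] s₀, (s - s₀) ^ d * f s = φ s) : MeromorphicAt f s₀ := by
  have h1 : MeromorphicAt (fun s => (s - s₀) ^ (-(d : ℤ)) • φ s) s₀ :=
    MeromorphicAt.smul (((MeromorphicAt.id s₀).sub (MeromorphicAt.const s₀ s₀)).zpow _)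
      hφ.meromorphicAt
  exact h1.congr (eventuallyEq_zpow_smul f φ s₀ d hf).symm

lemma meromorphicOrderAt_eq_neg (f φ : ℂ → ℂ) (s₀ : ℂ) (d : ℕ) (hφ : AnalyticAt ℂ φ s₀)
    (hφ0 : φ s₀ ≠ 0) (hf : ∀ᶠ s in 𝓝[≠] s₀, (s - s₀) ^ d * f s = φ s) :
    meromorphicOrderAt f s₀ = ((-(d : ℤ) : ℤ) : WithTop ℤ) := by
  rw [meromorphicOrderAt_eq_int_iff (meromorphicAt_of_pow_mul f φ s₀ d hφ hf)]
  exact ⟨φ, hφ, hφ0, eventuallyEq_zpow_smul f φ s₀ d hf⟩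

/-- Pole structure of the product of `(s + 1) ⋯ (s + n)` with the continued Mellin transform of a
function whose expansion has logarithms from order `n` on and squared logarithms from order `2 n`
on. -/
theorem exists_meromorphic_pole_structure (n : ℕ) (γ : ℂ) (hγ : γ ≠ 0)
    (a b c : ℕ → ℂ) (M : ℂ → ℂ)
    (hb0 : ∀ k < n, b k = 0) (hb : ∀ k, n ≤ k → k < 2 * n → b k ≠ 0)
    (hc0 : ∀ k < 2 * n, c k = 0) (hc : ∀ k, 2 * n ≤ k → c k ≠ 0)
    (hM : ∀ N : ℕ, ∃ g : ℂ → ℂ, ∀ s : ℂ, -(N : ℝ) - 1 < s.re → AnalyticAt ℂ g s ∧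
        M s = ∑ k ∈ Finset.range N, mellinPole (a k) (b k) (c k) k s + g s) :
    ∃ C : ℂ → ℂ,
      (∀ s : ℂ, -1 < s.re → C s = (∏ i ∈ Finset.range n, (s + 1 + i)) / γ * M s) ∧
      Meromorphic C ∧
      (∀ s : ℂ, (∀ m : ℕ, n + 1 ≤ m → s ≠ -(m : ℂ)) → AnalyticAt ℂ C s) ∧
      (∀ m : ℕ, n + 1 ≤ m → m ≤ 2 * n → meromorphicOrderAt C (-(m : ℂ)) = ((-2 : ℤ) : WithTop ℤ)) ∧
      (∀ j : ℕ, meromorphicOrderAt C (-2 * (n : ℂ) - 1 - (j : ℂ)) = ((-3 : ℤ) : WithTop ℤ)) ∧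
      (0 < n → Tendsto (fun s : ℂ => (s + (n : ℂ) + 1) ^ 2 * C s) (𝓝[≠] (-(n : ℂ) - 1))
        (𝓝 (-(b n) * ((-1) ^ n * n.factorial) / γ))) := by
  set pol : ℂ → ℂ := fun s => (∏ i ∈ Finset.range n, (s + 1 + i)) / γ with hpol
  have hpolan : ∀ s, AnalyticAt ℂ pol s := fun s => by
    have : AnalyticAt ℂ (fun s : ℂ => ∏ i ∈ Finset.range n, (s + 1 + i)) s :=
      Finset.analyticAt_fun_prod _ fun i _ => by fun_prop
    exact this.div analyticAt_const hγ
  have hpol0 : ∀ k : ℕ, n ≤ k → pol (-((k : ℂ) + 1)) ≠ 0 := by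
    intro k hk
    refine div_ne_zero (Finset.prod_ne_zero_iff.2 fun i hi h => ?_) hγ
    have hi' := Finset.mem_range.1 hi
    have : (i : ℂ) = k := by linear_combination h
    exact absurd (Nat.cast_injective this) (by omega)
  set C₀ : ℂ → ℂ := fun s => pol s * M s with hC₀
  -- isolating one term of the expansion
  have hloc : ∀ k : ℕ, ∃ G : ℂ → ℂ, AnalyticAt ℂ G (-((k : ℂ) + 1)) ∧
      ∀ᶠ s in 𝓝 (-((k : ℂ) + 1)), M s = mellinPole (a k) (b k) (c k) k s + G s := by
    intro k
    obtain ⟨g, hg⟩ := hM (k + 1)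
    have hre : -((k + 1 : ℕ) : ℝ) - 1 < (-((k : ℂ) + 1)).re := by simp; linarith
    refine ⟨fun s => ∑ i ∈ Finset.range k, mellinPole (a i) (b i) (c i) i s + g s, ?_, ?_⟩
    · refine AnalyticAt.add ?_ (hg _ hre).1
      refine Finset.analyticAt_fun_sum _ fun i hi => mellinPole_analyticAt _ _ _ _ _ fun h => ?_
      have : (k : ℂ) = i := by linear_combination -h
      exact absurd (Nat.cast_injective this) (by have := Finset.mem_range.1 hi; omega)
    · filter_upwards [(isOpen_lt continuous_const Complex.continuous_re).mem_nhds hre] with s hs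
      rw [(hg s hs).2, Finset.sum_range_succ]
      ring
  have hreg : ∀ s : ℂ, (∀ k : ℕ, s ≠ -((k : ℂ) + 1)) → AnalyticAt ℂ C₀ s := by
    intro s hs
    obtain ⟨g, hg⟩ := hM ⌈-s.re⌉₊
    have hre : -((⌈-s.re⌉₊ : ℕ) : ℝ) - 1 < s.re := by linarith [Nat.le_ceil (-s.re)]
    refine (hpolan s).mul (((Finset.analyticAt_fun_sum (Finset.range ⌈-s.re⌉₊) fun k _ =>
      mellinPole_analyticAt (a k) (b k) (c k) k s (hs k)).add (hg s hre).1).congr ?_)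
    filter_upwards [(isOpen_lt continuous_const Complex.continuous_re).mem_nhds hre] with z hz
    exact (hg z hz).2.symm
  have hpole3 : ∀ k : ℕ, ∃ φ : ℂ → ℂ, AnalyticAt ℂ φ (-((k : ℂ) + 1)) ∧
      φ (-((k : ℂ) + 1)) = pol (-((k : ℂ) + 1)) * (2 * c k) ∧
      ∀ᶠ s in 𝓝[≠] (-((k : ℂ) + 1)), (s - -((k : ℂ) + 1)) ^ 3 * C₀ s = φ s := by
    intro k
    obtain ⟨G, hG, hMG⟩ := hloc k
    refine ⟨fun s => pol s * (a k * (s - -((k : ℂ) + 1)) ^ 2 - b k * (s - -((k : ℂ) + 1)) +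
      2 * c k + (s - -((k : ℂ) + 1)) ^ 3 * G s), ?_, by simp, ?_⟩
    · have := hpolan (-((k : ℂ) + 1))
      fun_prop
    · filter_upwards [hMG.filter_mono nhdsWithin_le_nhds, self_mem_nhdsWithin] with s hs hne
      have h0 : s + k + 1 ≠ 0 := fun h => hne (by
        rw [Set.mem_singleton_iff]; linear_combination h)
      simp only [hC₀, hs, mellinPole, show s - -((k : ℂ) + 1) = s + k + 1 by ring]
      field_simp
  have hpole2 : ∀ k < 2 * n, ∃ φ : ℂ → ℂ, AnalyticAt ℂ φ (-((k : ℂ) + 1)) ∧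
      φ (-((k : ℂ) + 1)) = pol (-((k : ℂ) + 1)) * (-b k) ∧
      ∀ᶠ s in 𝓝[≠] (-((k : ℂ) + 1)), (s - -((k : ℂ) + 1)) ^ 2 * C₀ s = φ s := by
    intro k hk
    obtain ⟨G, hG, hMG⟩ := hloc k
    refine ⟨fun s => pol s * (a k * (s - -((k : ℂ) + 1)) - b k +
      (s - -((k : ℂ) + 1)) ^ 2 * G s), ?_, by simp, ?_⟩
    · have := hpolan (-((k : ℂ) + 1))
      fun_prop
    · filter_upwards [hMG.filter_mono nhdsWithin_le_nhds, self_mem_nhdsWithin] with s hs hne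
      have h0 : s + k + 1 ≠ 0 := fun h => hne (by
        rw [Set.mem_singleton_iff]; linear_combination h)
      simp only [hC₀, hs, mellinPole, hc0 k hk, show s - -((k : ℂ) + 1) = s + k + 1 by ring]
      field_simp
      ring
  -- the simple poles at `-1, …, -n` are cancelled by the polynomial factor
  have hpole1 : ∀ k < n, ∃ φ : ℂ → ℂ, AnalyticAt ℂ φ (-((k : ℂ) + 1)) ∧
      C₀ =ᶠ[𝓝[≠] (-((k : ℂ) + 1))] φ := by
    intro k hk
    obtain ⟨G, hG, hMG⟩ := hloc k
    refine ⟨fun s => (∏ i ∈ (Finset.range n).erase k, (s + 1 + i)) / γ * a k + pol s * G s, ?_, ?_⟩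
    · have h1 := hpolan (-((k : ℂ) + 1))
      have h2 : AnalyticAt ℂ (fun s : ℂ => ∏ i ∈ (Finset.range n).erase k, (s + 1 + i))
          (-((k : ℂ) + 1)) := Finset.analyticAt_fun_prod _ fun i _ => by fun_prop
      exact ((h2.div analyticAt_const hγ).mul analyticAt_const).add (h1.mul hG)
    · filter_upwards [hMG.filter_mono nhdsWithin_le_nhds, self_mem_nhdsWithin] with s hs hne
      have h0 : s + k + 1 ≠ 0 := fun h => hne (by
        rw [Set.mem_singleton_iff]; linear_combination h)
      simp only [hC₀, hs, mellinPole, hc0 k (by omega), hb0 k hk]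
      have h1 : pol s = (s + k + 1) * (∏ i ∈ (Finset.range n).erase k, (s + 1 + i)) / γ := by
        simp only [hpol]
        rw [← Finset.mul_prod_erase _ _ (Finset.mem_range.2 hk)]
        ring
      rw [mul_add, h1]
      field_simp
      ring
  have hmer : MeromorphicOn C₀ Set.univ := by
    intro s _
    by_cases hs : ∃ k : ℕ, s = -((k : ℂ) + 1)
    · obtain ⟨k, rfl⟩ := hs
      obtain ⟨φ, h1, -, h2⟩ := hpole3 k
      exact meromorphicAt_of_pow_mul C₀ φ _ 3 h1 h2
    · push Not at hs
      exact (hreg s hs).meromorphicAt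
  -- the values of `C₀` at removable singularities are junk; the normal form repairs them
  set C := toMeromorphicNFOn C₀ Set.univ with hC
  have hNF : ∀ s, MeromorphicNFAt C s := fun s =>
    meromorphicNFOn_toMeromorphicNFOn C₀ _ (Set.mem_univ s)
  have hord : ∀ s, meromorphicOrderAt C s = meromorphicOrderAt C₀ s := fun s =>
    meromorphicOrderAt_toMeromorphicNFOn hmer (Set.mem_univ s)
  have hne : ∀ s, C₀ =ᶠ[𝓝[≠] s] C := fun s =>
    (hmer.toMeromorphicNFOn_eq_self_on_nhdsNE (Set.mem_univ s)).symm
  refine ⟨C, fun s hs => ?_, fun s => (hNF s).meromorphicAt, fun s hs => ?_, fun m hm hm2 => ?_,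
    fun j => ?_, fun hn => ?_⟩
  · have h1 : AnalyticAt ℂ C₀ s := hreg s fun k hk => by
      have := congrArg Complex.re hk
      simp at this
      linarith [Nat.cast_nonneg (α := ℝ) k]
    exact (((hNF s).eventuallyEq_nhdsNE_iff_eventuallyEq_nhds h1.meromorphicNFAt).1
      (hne s).symm).eq_of_nhds
  · rw [← (hNF s).meromorphicOrderAt_nonneg_iff_analyticAt, hord]
    by_cases h : ∃ k : ℕ, s = -((k : ℂ) + 1)
    · obtain ⟨k, rfl⟩ := h
      have hk : k < n := by
        by_contra hk
        exact hs (k + 1) (by omega) (by push_cast; ring)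
      obtain ⟨φ, h1, h2⟩ := hpole1 k hk
      rw [meromorphicOrderAt_congr h2]
      exact h1.meromorphicOrderAt_nonneg
    · push Not at h
      exact (hreg s h).meromorphicOrderAt_nonneg
  · obtain ⟨k, rfl⟩ : ∃ k, m = k + 1 := ⟨m - 1, by omega⟩
    obtain ⟨φ, h1, h2, h3⟩ := hpole2 k (by omega)
    rw [hord, show (-((k + 1 : ℕ) : ℂ)) = -((k : ℂ) + 1) by push_cast; ring]
    refine meromorphicOrderAt_eq_neg C₀ φ _ 2 h1 ?_ h3
    rw [h2]
    exact mul_ne_zero (hpol0 k (by omega)) (neg_ne_zero.2 (hb k (by omega) (by omega)))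
  · obtain ⟨φ, h1, h2, h3⟩ := hpole3 (2 * n + j)
    rw [hord, show -2 * (n : ℂ) - 1 - j = -(((2 * n + j : ℕ) : ℂ) + 1) by push_cast; ring]
    refine meromorphicOrderAt_eq_neg C₀ φ _ 3 h1 ?_ h3
    rw [h2]
    exact mul_ne_zero (hpol0 _ (by omega)) (mul_ne_zero two_ne_zero (hc _ (by omega)))
  · obtain ⟨φ, h1, h2, h3⟩ := hpole2 n (by omega)
    have h4 : pol (-((n : ℂ) + 1)) = (-1) ^ n * n.factorial / γ := by
      simp only [hpol]
      congr 1
      rw [← Finset.prod_range_reflect, ← Finset.prod_range_add_one_eq_factorial]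
      push_cast
      rw [← Finset.card_range n, ← Finset.prod_const, Finset.card_range, ← Finset.prod_mul_distrib]
      refine Finset.prod_congr rfl fun i hi => ?_
      have hi' := Finset.mem_range.1 hi
      rw [show n - 1 - i = n - (i + 1) by omega, Nat.cast_sub (by omega)]
      push_cast
      ring
    have h5 : φ (-((n : ℂ) + 1)) = -(b n) * ((-1) ^ n * n.factorial) / γ := by
      rw [h2, h4]; ring
    rw [← h5, show -(n : ℂ) - 1 = -((n : ℂ) + 1) by ring]
    refine (h1.continuousAt.tendsto.mono_left nhdsWithin_le_nhds).congr' ?_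
    filter_upwards [h3, hne (-((n : ℂ) + 1))] with s hs hs2
    rw [← hs, ← hs2]
    ring

/-! ### Nonvanishing of the leading coefficients -/

lemma logStrength_ne_zero (a b N : ℕ) : logStrength a b N ≠ 0 := by
  unfold logStrength; positivity

/-- The coefficients of the squared logarithm are those of a product of series with nonnegative
coefficients. -/
lemma coeff_logPoly_sq_div_pos (a b n d j : ℕ) (hd : 0 < d) :
    0 < PowerSeries.coeff j (divOneSubPowSeries (logPoly a b n ^ 2) d) := by
  have h1 : ∀ k, 0 ≤ (logPoly a b n ^ 2).coeff k := fun k => by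
    rw [pow_two, Polynomial.coeff_mul]
    refine Finset.sum_nonneg fun i _ => ?_
    rw [coeff_logPoly, coeff_logPoly]
    exact mul_nonneg (logCoeff_nonneg _ _ _ _) (logCoeff_nonneg _ _ _ _)
  have h2 : (logPoly a b n ^ 2).coeff 0 = 1 := by
    rw [pow_two, Polynomial.mul_coeff_zero, coeff_logPoly, logCoeff_zero, mul_one]
  have h3 : ∀ k, 0 < PowerSeries.coeff k (PowerSeries.invOneSubPow ℝ d).val := fun k => by
    rw [PowerSeries.invOneSubPow_val_eq_mk_sub_one_add_choose_of_pos ℝ d hd, PowerSeries.coeff_mk]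
    exact_mod_cast Nat.choose_pos (Nat.le_add_right _ _)
  rw [divOneSubPowSeries, PowerSeries.coeff_mul]
  refine Finset.sum_pos' (fun i _ => ?_) ⟨(0, j), by simp, ?_⟩
  · rw [Polynomial.coeff_coe]
    exact mul_nonneg (h1 _) (h3 _).le
  · rw [Polynomial.coeff_coe, h2, one_mul]
    exact h3 j

lemma coeff_divOneSubPowSeries_C_mul_X_pow_mul (r : ℝ) (e : ℕ) (G : Polynomial ℝ) (d k : ℕ) :
    PowerSeries.coeff k
      (divOneSubPowSeries (Polynomial.C r * (Polynomial.X ^ e * G)) d) =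
      r * if e ≤ k then PowerSeries.coeff (k - e) (divOneSubPowSeries G d) else 0 := by
  have : divOneSubPowSeries (Polynomial.C r * (Polynomial.X ^ e * G)) d =
      PowerSeries.C r * (PowerSeries.X ^ e * divOneSubPowSeries G d) := by
    simp only [divOneSubPowSeries]
    push_cast
    ring
  rw [this, PowerSeries.coeff_C_mul, PowerSeries.coeff_X_pow_mul']

lemma continuousOn_mhDensity (a b N : ℕ) : ContinuousOn (mhDensity a b N) (Set.Ioc 0 1) := by
  have h1 : ContinuousOn (fun x => hypSum a b N (1 - x)) (Set.Ioc 0 1) :=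
    (continuousOn_hypSum a b N).comp (by fun_prop) fun x hx =>
      ⟨by linarith [hx.2], by linarith [hx.1]⟩
  unfold mhDensity
  exact Complex.continuous_ofReal.comp_continuousOn
    (ContinuousOn.mul (by fun_prop) ((h1.div_const _).pow 2))

lemma ofReal_divOneSubPowSeries_isBigO (G : Polynomial ℝ) (d M : ℕ) :
    (fun x : ℝ => ((G.eval x / (1 - x) ^ d : ℝ) : ℂ) -
      ∑ k ∈ Finset.range M, ((PowerSeries.coeff k (divOneSubPowSeries G d) : ℝ) : ℂ) * (x : ℂ) ^ k)
      =O[𝓝[>] 0] fun x : ℝ => x ^ M := by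
  have h := Complex.isBigO_ofReal_left.2 (divOneSubPowSeries_isBigO G d M)
  refine h.congr_left fun x => ?_
  push_cast
  rfl

theorem mainTheorem2 (n p q : ℕ) (hn : 1 ≤ n) (hpq : 0 < p * q) :
    ∃ C : ℂ → ℂ,
      -- `C` is a meromorphic extension of `C_{pq}` from the half-plane `Re s > -1`
      (∀ s : ℂ, -1 < s.re → C s = mhCoeff n p q s) ∧
      Meromorphic C ∧
      -- holomorphic away from the points `-n-1, -n-2, …`
      (∀ s : ℂ, (∀ m : ℕ, n + 1 ≤ m → s ≠ -(m : ℂ)) → AnalyticAt ℂ C s) ∧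
      -- double poles at `-n-1, …, -2n`
      (∀ m : ℕ, n + 1 ≤ m → m ≤ 2 * n → meromorphicOrderAt C (-(m : ℂ)) = ((-2 : ℤ) : WithTop ℤ)) ∧
      -- triple poles at `-2n-1-j`, `j = 0, 1, 2, …`
      (∀ j : ℕ, meromorphicOrderAt C (-2 * (n : ℂ) - 1 - (j : ℂ)) = ((-3 : ℤ) : WithTop ℤ)) ∧
      -- the strength of the double pole at `-n-1`
      Tendsto (fun s : ℂ => (s + (n : ℂ) + 1) ^ 2 * C s) (𝓝[≠] (-(n : ℂ) - 1))
        (𝓝 (2 * (ascPochhammer ℂ n).eval (p : ℂ) * (ascPochhammer ℂ n).eval (q : ℂ) /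
          Complex.Gamma (n : ℂ) ^ 2)) := by
  obtain ⟨N, rfl⟩ : ∃ N, n = N + 1 := ⟨n - 1, by omega⟩
  obtain ⟨a, rfl⟩ : ∃ a, p = a + 1 :=
    ⟨p - 1, by have := Nat.pos_of_mul_pos_right hpq; omega⟩
  obtain ⟨b, rfl⟩ : ∃ b, q = b + 1 :=
    ⟨q - 1, by have := Nat.pos_of_mul_pos_left hpq; omega⟩
  obtain ⟨Q, hQ, hQ0, hQrec⟩ := exists_hypSum_log_expansion a b N
  set d := a + b + N + 2 with hd
  set β := logStrength a b N with hβ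
  have hβ0 : β ≠ 0 := logStrength_ne_zero a b N
  set P := logPoly a b (N + 1) with hP
  set GB : Polynomial ℝ := Polynomial.C (2 * β) * (Polynomial.X ^ (N + 1) * (P * Q)) with hGB
  set GC : Polynomial ℝ := Polynomial.C (β ^ 2) * (Polynomial.X ^ (2 * (N + 1)) * P ^ 2) with hGC
  have hγ : Complex.Gamma ((N + 1 : ℕ) : ℂ) = N.factorial := by
    rw [Nat.cast_succ, Complex.Gamma_nat_eq_factorial]
  have hγ0 : Complex.Gamma ((N + 1 : ℕ) : ℂ) ≠ 0 := by
    rw [hγ]; exact Nat.cast_ne_zero.2 (Nat.factorial_ne_zero N)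
  obtain ⟨M, hM1, hM2⟩ := exists_mellin_continuation (mhDensity a b N)
    (fun x => (((Q ^ 2).eval x / (1 - x) ^ d : ℝ) : ℂ))
    (fun x => ((GB.eval x / (1 - x) ^ d : ℝ) : ℂ))
    (fun x => ((GC.eval x / (1 - x) ^ d : ℝ) : ℂ))
    (fun k => ((PowerSeries.coeff k (divOneSubPowSeries (Q ^ 2) d) : ℝ) : ℂ))
    (fun k => ((PowerSeries.coeff k (divOneSubPowSeries GB d) : ℝ) : ℂ))
    (fun k => ((PowerSeries.coeff k (divOneSubPowSeries GC d) : ℝ) : ℂ))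
    (continuousOn_mhDensity a b N) (fun x hx => by
      have hx1 : (1 - x) ^ d ≠ 0 := pow_ne_zero _ (by linarith [hx.2])
      have h1 : (1 - x) ^ d * (hypSum a b N (1 - x) / hypSum a b N 1) ^ 2 =
          (Q ^ 2).eval x / (1 - x) ^ d + GB.eval x / (1 - x) ^ d * Real.log x +
            GC.eval x / (1 - x) ^ d * Real.log x ^ 2 := by
        have h2 : (1 - x) ^ d * (hypSum a b N (1 - x) / hypSum a b N 1) ^ 2 =
            ((1 - x) ^ d * (hypSum a b N (1 - x) / hypSum a b N 1)) ^ 2 / (1 - x) ^ d := by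
          rw [mul_pow, sq ((1 - x) ^ d)]
          field_simp
        rw [h2, hQ x hx]
        simp only [hGB, hGC, Polynomial.eval_mul, Polynomial.eval_pow, Polynomial.eval_C,
          Polynomial.eval_X]
        ring
      rw [mhDensity, h1]
      push_cast
      ring)
    (ofReal_divOneSubPowSeries_isBigO _ _) (ofReal_divOneSubPowSeries_isBigO _ _)
    (ofReal_divOneSubPowSeries_isBigO _ _)
  have hPQ : divOneSubPowSeries (P * Q) d = (P : PowerSeries ℝ) * divOneSubPowSeries Q d := by
    simp only [divOneSubPowSeries]; push_cast; ring
  have hPc : ∀ k, PowerSeries.coeff k (P : PowerSeries ℝ) = logCoeff a b (N + 1) k := fun k => by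
    rw [Polynomial.coeff_coe, coeff_logPoly]
  have hw : ∀ m < N + 1, PowerSeries.coeff m (divOneSubPowSeries (P * Q) d) ≠ 0 := by
    intro m hm h0
    have h := coeff_mul_hypergeometric_pos (N + 1) (a + 1) (b + 1) (by omega) (by omega)
      (P : PowerSeries ℝ) (divOneSubPowSeries Q d) (by rw [hPc, logCoeff_zero]) hQ0
      (fun k => by
        rw [hPc, hPc]
        have := logCoeff_succ a b (N + 1) k
        push_cast at this ⊢
        linear_combination this) hQrec m hm
    rw [← hPQ, h0, mul_zero] at h
    exact lt_irrefl _ h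
  obtain ⟨C, hC1, hC2, hC3, hC4, hC5, hC6⟩ := exists_meromorphic_pole_structure (N + 1) _ hγ0
    (fun k => ((PowerSeries.coeff k (divOneSubPowSeries (Q ^ 2) d) : ℝ) : ℂ))
    (fun k => ((PowerSeries.coeff k (divOneSubPowSeries GB d) : ℝ) : ℂ))
    (fun k => ((PowerSeries.coeff k (divOneSubPowSeries GC d) : ℝ) : ℂ)) M
    (fun k hk => by
      rw [hGB, coeff_divOneSubPowSeries_C_mul_X_pow_mul, if_neg (by omega)]; simp)
    (fun k hk hk2 => by
      rw [hGB, coeff_divOneSubPowSeries_C_mul_X_pow_mul, if_pos hk]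
      exact Complex.ofReal_ne_zero.2
        (mul_ne_zero (mul_ne_zero two_ne_zero hβ0) (hw _ (by omega))))
    (fun k hk => by
      rw [hGC, coeff_divOneSubPowSeries_C_mul_X_pow_mul, if_neg (by omega)]; simp)
    (fun k hk => by
      rw [hGC, coeff_divOneSubPowSeries_C_mul_X_pow_mul, if_pos hk]
      exact Complex.ofReal_ne_zero.2
        (mul_ne_zero (pow_ne_zero 2 hβ0) (coeff_logPoly_sq_div_pos _ _ _ _ _ (by omega)).ne'))
    hM2
  refine ⟨C, fun s hs => ?_, hC2, hC3, hC4, hC5, ?_⟩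
  · rw [hC1 s hs, hM1 s hs, mhCoeff_eq_mellin a b N s hs]
  · have hb : PowerSeries.coeff (N + 1) (divOneSubPowSeries GB d) = 2 * β := by
      rw [hGB, coeff_divOneSubPowSeries_C_mul_X_pow_mul, if_pos le_rfl, Nat.sub_self, hPQ,
        PowerSeries.coeff_mul, Finset.Nat.antidiagonal_zero, Finset.sum_singleton, hPc, logCoeff_zero, hQ0]
      ring
    have hpoch : ∀ e : ℕ, (ascPochhammer ℂ (N + 1)).eval ((e + 1 : ℕ) : ℂ) =
        ((e + N + 1).factorial : ℂ) / e.factorial := by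
      intro e
      rw [← ascPochhammer_eval_cast, ascPochhammer_nat_eq_ascFactorial, eq_div_iff
        (Nat.cast_ne_zero.2 (Nat.factorial_ne_zero e)), mul_comm]
      exact_mod_cast Nat.factorial_mul_ascFactorial e (N + 1)
    have h := hC6 (Nat.succ_pos N)
    convert! h using 2
    rw [hpoch, hpoch, hb, hβ, logStrength, hγ]
    have h1 : ((-1 : ℂ) ^ N) * (-1) ^ N = 1 := by rw [← mul_pow]; simp
    have hf : ∀ m : ℕ, (m.factorial : ℂ) ≠ 0 := fun m =>
      Nat.cast_ne_zero.2 (Nat.factorial_ne_zero m)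
    have f1 := hf a
    have f2 := hf b
    have f3 := hf N
    have f4 := hf (N + 1)
    push_cast
    field_simp
    linear_combination (-((a + N + 1).factorial * (b + N + 1).factorial) : ℂ) * h1
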